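/- Points of space and of images are points of $\mathbb{P}^3=\mathbb{P}^3(\mathbb{C})$ and $\mathbb{P}^2=\mathbb{P}^2(\mathbb{C})$. A camera is a real $3\times 4$ matrix $P$ of rank $3$; its centre is the point of $\mathbb{P}^3$ given by its kernel. A configuration $(P_1,\dots,P_n,X)$ consists of $n$ cameras with pairwise distinct centres and a set $X\subseteq\mathbb{P}^3$. A tuple $s=(s_1,\dots,s_n)\in(\mathbb{P}^2)^n$ is an image of $x\in\mathbb{P}^3$ if $(x,s)$ lies in the closure of the graph of the joint camera map $x\mapsto(P_1x,\dots,P_nx)$, that is, if for every $i$ the vector $P_ix$ is a (possibly zero) multiple of $s_i$. The configuration is a reconstruction of $S\subseteq(\mathbb{P}^2)^n$ if every $s\in S$ is an image of some $x\in X$ and every $x\in X$ has an image in $S$. Two configurations $(P_1,\dots,P_n,X)$ and $(Q_1,\dots,Q_n,Y)$ are equivalent if there is $H\in\mathrm{PGL}(4)$ with $H(X)=Y$ and $P_iH^{-1}=Q_i$ (up to scale) for all $i$, and conjugate if they are nonequivalent reconstructions of the same set. The fundamental matrix $F_P^{ij}$ is the real $3\times3$ matrix, considered up to a nonzero factor,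 of the bilinear form $\mathbf{x}^TF_P^{ij}\mathbf{y}=\det\begin{bmatrix}P_i&\mathbf{x}&0\\P_j&0&\mathbf{y}\end{bmatrix}$. A configuration is (non-trivially) critical if it has a conjugate configuration with $F_P^{ij}\neq F_Q^{ij}$ for all $i\neq j$. **Proposition.** Let $C\subset\mathbb{P}^3$ be an irreducible quartic curve that is the intersection of two real quadrics, i.e. $C=\{q_1=q_2=0\}$ where $q_1,q_2$ are linearly independent real quadratic forms that generate a prime ideal of $\mathbb{C}[x_0,x_1,x_2,x_3]$ (so $C$ is a smooth elliptic quartic, or a singular rational quartic with a node or a cusp). Let $n\ge 2$, and let $(P_1,\dots,P_n,X)$ be a configuration such that all camera centres and all points of $X$ lie on $C$ and no camera centre is a singular point of $C$. Then $(P_1,\dots,P_n,X)$ is a (non-trivial) critical configuration. -/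

import Mathlib

open scoped LinearAlgebra.Projectivization Matrix

namespace Vision

/-- Complex projective 3-space, the space of space points. -/
abbrev Space : Type := ℙ ℂ (Fin 4 → ℂ)

/-- Complex projective plane, the space of image points. -/
abbrev ImagePlane : Type := ℙ ℂ (Fin 3 → ℂ)

/-! ### Cameras -/

/-- A (real projective pinhole) camera: a real `3 × 4` matrix of full rank. -/
structure Camera where
  mat : Matrix (Fin 3) (Fin 4) ℝ
  full_rank : mat.rank = 3

namespace Camera

/-- The camera matrix with its entries regarded as complex numbers. -/
noncomputable def matC (P : Camera) : Matrix (Fin 3) (Fin 4) ℂ :=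
  P.mat.map (algebraMap ℝ ℂ)

theorem finrank_ker (P : Camera) :
    Module.finrank ℂ (LinearMap.ker P.matC.mulVecLin) = 1 := by
  have hs : Function.Surjective P.mat.mulVecLin := by
    rw [← LinearMap.range_eq_top]
    apply Submodule.eq_top_of_finrank_eq
    have h := P.full_rank
    rw [Matrix.rank] at h
    rw [h]
    simp
  choose b hb using fun j : Fin 3 => hs (Pi.single j 1)
  have hB : P.mat * (Matrix.of b)ᵀ = 1 := by
    ext i j
    have := congrFun (hb j) i
    simpa [Matrix.mul_apply, Matrix.mulVec, dotProduct, Matrix.one_apply, Pi.single_apply]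
      using this
  have hBC : P.matC * ((Matrix.of b)ᵀ).map (algebraMap ℝ ℂ) = 1 := by
    rw [matC, ← Matrix.map_mul, hB, Matrix.map_one _ (map_zero _) (map_one _)]
  have hsC : Function.Surjective P.matC.mulVecLin := fun v =>
    ⟨((Matrix.of b)ᵀ).map (algebraMap ℝ ℂ) *ᵥ v, by
      rw [Matrix.mulVecLin_apply, Matrix.mulVec_mulVec, hBC, Matrix.one_mulVec]⟩
  have h := LinearMap.finrank_range_add_finrank_ker P.matC.mulVecLin
  rw [LinearMap.range_eq_top.2 hsC] at h
  simp at h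
  omega

/-- The camera centre: the point of projective space given by the kernel of the camera matrix. -/
noncomputable def center (P : Camera) : Space :=
  Projectivization.mk'' (LinearMap.ker P.matC.mulVecLin) P.finrank_ker

/-- The image point `s` is an image of the space point `x`: the vector `P x` is a multiple of `s`.
If `x` is not the camera centre then `P x ≠ 0` and this says `s = P(x)`; if `x` is the camera
centre then `P x = 0` and every `s` qualifies. -/
def IsImage (P : Camera) (x : Space) (s : ImagePlane) : Prop :=
  ∃ c : ℂ, P.matC *ᵥ x.rep = c • s.rep

/-- The `6 × 6` matrix `[P x 0; P' 0 y]`. -/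
noncomputable def pairMatrix (P P' : Camera) (x y : Fin 3 → ℝ) : Matrix (Fin 6) (Fin 6) ℝ :=
  Matrix.reindex (finSumFinEquiv : Fin 3 ⊕ Fin 3 ≃ Fin 6) (finSumFinEquiv : Fin 4 ⊕ Fin 2 ≃ Fin 6)
    (Matrix.fromBlocks P.mat (Matrix.of fun i => ![x i, 0]) P'.mat (Matrix.of fun i => ![0, y i]))

/-- The fundamental matrix of a pair of cameras: the matrix `F` of the bilinear form
`xᵀ F y = det [P x 0; P' 0 y]`. It is meaningful up to a nonzero factor. -/
noncomputable def fundamentalMatrix (P P' : Camera) : Matrix (Fin 3) (Fin 3) ℝ :=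
  Matrix.of fun a b => (pairMatrix P P' (Pi.single a 1) (Pi.single b 1)).det

end Camera

/-! ### Configurations and criticality -/

/-- A configuration of `n` cameras with distinct centres and a set of space points. -/
structure Configuration (n : ℕ) where
  camera : Fin n → Camera
  center_injective : Function.Injective fun i => (camera i).center
  points : Set Space

namespace Configuration

variable {n : ℕ}

/-- `s ∈ (ℙ²)ⁿ` is an image of `x` under the joint camera map. As the centres are distinct, the
pairs `(x, s)` with this property form the closure of the graph of the joint camera map: away from
the centres `s = (P₁(x), …, Pₙ(x))`, and at the `i`-th centre the `i`-th image point is free. -/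
def IsImage (K : Configuration n) (x : Space) (s : Fin n → ImagePlane) : Prop :=
  ∀ i, (K.camera i).IsImage x (s i)

/-- `K` is a reconstruction of the set `S ⊆ (ℙ²)ⁿ`: every element of `S` is an image of a point of
`K`, and every point of `K` has an image in `S`. If no point of `K` is a camera centre, this says
that `S` is the image of the set of points under the joint camera map. -/
def IsReconstruction (K : Configuration n) (S : Set (Fin n → ImagePlane)) : Prop :=
  (∀ s ∈ S, ∃ x ∈ K.points, K.IsImage x s) ∧ (∀ x ∈ K.points, ∃ s ∈ S, K.IsImage x s)

/-- Equivalence of configurations: they differ by a projective transformation of space. Camera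
matrices are compared up to a nonzero factor. -/
def Equivalent (K L : Configuration n) : Prop :=
  ∃ H : GL (Fin 4) ℂ, (fun x : Space => H • x) '' K.points = L.points ∧
    ∀ i, ∃ c : ℂ, c ≠ 0 ∧ (K.camera i).matC * (H⁻¹).val = c • (L.camera i).matC

/-- Conjugate configurations: nonequivalent reconstructions of the same set. -/
def Conjugate (K L : Configuration n) : Prop :=
  (∃ S : Set (Fin n → ImagePlane), K.IsReconstruction S ∧ L.IsReconstruction S) ∧
    ¬ K.Equivalent L

/-- A critical configuration: one that has a conjugate configuration. -/
def IsCritical (K : Configuration n) : Prop :=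
  ∃ L : Configuration n, K.Conjugate L

/-- A non-trivial critical configuration: one that has a conjugate configuration such that, for
every pair of views, the fundamental matrices of the two configurations are different (as matrices
up to a nonzero factor). -/
def IsNontrivialCritical (K : Configuration n) : Prop :=
  ∃ L : Configuration n, K.Conjugate L ∧ ∀ i j, i ≠ j → ¬ ∃ c : ℝ, c ≠ 0 ∧
    (L.camera i).fundamentalMatrix (L.camera j) =
      c • (K.camera i).fundamentalMatrix (K.camera j)

end Configuration

/-! ### Irreducible quartic curves that are intersections of two quadrics -/

/-- `q₁ = q₂ = 0` is an irreducible quartic curve: `q₁, q₂` are linearly independent real quadratic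
forms, and the homogeneous ideal they generate over `ℂ` is prime. Then the two quadrics have no
common component, so that they meet in a curve of degree `4` (Bézout), and this curve is reduced
and irreducible over `ℂ`, with `(q₁, q₂)` as its ideal. Such a curve is either smooth (an elliptic
quartic) or a singular rational quartic (with a node or a cusp). -/
structure IsIrreducibleQuartic (q₁ q₂ : MvPolynomial (Fin 4) ℝ) : Prop where
  homogeneous_left : q₁.IsHomogeneous 2
  homogeneous_right : q₂.IsHomogeneous 2
  linearIndependent : LinearIndependent ℝ ![q₁, q₂]
  isPrime : (Ideal.span {MvPolynomial.map (algebraMap ℝ ℂ) q₁,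
    MvPolynomial.map (algebraMap ℝ ℂ) q₂}).IsPrime

/-- The complex points of the intersection of the two quadrics. -/
def quarticCurve (q₁ q₂ : MvPolynomial (Fin 4) ℝ) : Set Space :=
  {x | MvPolynomial.aeval x.rep q₁ = 0 ∧ MvPolynomial.aeval x.rep q₂ = 0}

/-- The gradient of `q` at (a representative of) `x`. -/
noncomputable def gradient (q : MvPolynomial (Fin 4) ℝ) (x : Space) : Fin 4 → ℂ :=
  fun i => MvPolynomial.aeval x.rep (MvPolynomial.pderiv i q)

/-- Singular points of the curve `q₁ = q₂ = 0`, by the Jacobian criterion (`q₁` and `q₂` generate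
the ideal of the curve): the points of the curve where the gradients are linearly dependent. -/
def IsSingularPoint (q₁ q₂ : MvPolynomial (Fin 4) ℝ) (x : Space) : Prop :=
  x ∈ quarticCurve q₁ q₂ ∧ ¬ LinearIndependent ℂ ![gradient q₁ x, gradient q₂ x]

end Vision

namespace Vision

/-! Put one smooth camera centre p at (0:0:0:1) and a further real point o of C at (0:0:1:0). After
a change of generators the pencil is q₁ = wx + B, q₂ = wz + A, where A = ax² + bxy + cy² and B = dx²
+ exy + fy² + gxz + hyz. Projection from p maps C to the plane cubic xA − zB = 0. This cubic can
also be written x(A − dxz − gz²) = yz(ex + fy + hz), so that tx + z(ex + fy + hz) = 0 and ty + A −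
dxz − gz² = 0 define a second space curve over the same cubic; in it the image of o takes the role
that the tangent direction at p, with image (0:1:0), has for C.

The conjugate of (x:y:z:w) is (x:y:z:t). The first camera is unchanged, and for every other centre ξ
on C the explicit camera `targetCamera ξ` sees (x:y:z:t) where the projection from ξ sees (x:y:z:w)
(`parallel_target`, `exists_conjugate_point`). Since t does not depend on ξ, this serves all cameras
and all points at once.

Irreducibility enters only through `PrimePencil`: no quadric of the pencil splits and the curve
contains no line. This yields rank 3, distinct conjugate centres, and for each pair of views a real
v whose two images satisfy the epipolar relation of the given cameras but not that of the conjugate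
ones (`base_pair_nondegenerate`, `pair_nondegenerate`). Such a v separates the fundamental matrices
and also excludes equivalence (`not_equivalent`).

The point o must avoid finitely many planes through p (`exists_real_point`): a real plane cubic has
infinitely many real points, and irreducibility prevents finitely many lines from covering them. -/

/-- The value at `v` of the quadratic form with matrix `S`. -/
def quad {k : Type*} [Field k] (S : Matrix (Fin 4) (Fin 4) k) (v : Fin 4 → k) : k :=
  v ⬝ᵥ S *ᵥ v

/-- The consequences, in degrees two and three, of the fact that two quadratic forms are
independent and generate a prime ideal. -/
structure PrimePencil (q₁ q₂ : (Fin 4 → ℝ) → ℝ) : Prop where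
  indep : ∀ α β : ℝ, (∀ v, α * q₁ v + β * q₂ v = 0) → α = 0 ∧ β = 0
  irred : ∀ (α β : ℝ) (a b : Fin 4 → ℝ),
    (∀ v, (a ⬝ᵥ v) * (b ⬝ᵥ v) = α * q₁ v + β * q₂ v) → a = 0 ∨ b = 0
  prime : ∀ (a : Fin 4 → ℝ) (S : Matrix (Fin 4) (Fin 4) ℝ) (m₁ m₂ : Fin 4 → ℝ),
    (∀ v, (a ⬝ᵥ v) * quad S v = (m₁ ⬝ᵥ v) * q₁ v + (m₂ ⬝ᵥ v) * q₂ v) →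
      a = 0 ∨ ∃ α β : ℝ, ∀ v, quad S v = α * q₁ v + β * q₂ v

/-- Two vectors are proportional: all their `2 × 2` minors vanish. -/
def Parallel {k : Type*} [Field k] (u v : Fin 3 → k) : Prop :=
  ∀ i j, u i * v j = u j * v i

theorem parallel_of_minors {k : Type*} [Field k] {u v : Fin 3 → k}
    (h₀₁ : u 0 * v 1 = u 1 * v 0) (h₀₂ : u 0 * v 2 = u 2 * v 0) (h₁₂ : u 1 * v 2 = u 2 * v 1) :
    Parallel u v := by
  intro i j
  fin_cases i <;> fin_cases j <;> simp [h₀₁, h₀₂, h₁₂]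

/-! ### The normal form of the pencil and the explicit conjugate cameras. -/

/-- Coefficients of the normal form `wx + dx² + exy + fy² + gxz + hyz`, `wz + ax² + bxy + cy²` of
a pencil of quadrics through `(0 : 0 : 1 : 0)` and `(0 : 0 : 0 : 1)`. -/
structure QuarticCoeff (k : Type*) where
  (a b c d e f g h : k)

namespace QuarticCoeff

section Field

variable {k : Type*} [Field k] (q : QuarticCoeff k)

def form₁ (v : Fin 4 → k) : k :=
  v 3 * v 0 + q.d * v 0 ^ 2 + q.e * v 0 * v 1 + q.f * v 1 ^ 2 + q.g * v 0 * v 2 + q.h * v 1 * v 2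

def form₂ (v : Fin 4 → k) : k :=
  v 3 * v 2 + q.a * v 0 ^ 2 + q.b * v 0 * v 1 + q.c * v 1 ^ 2

/-- The projection from `(0 : 0 : 0 : 1)`. -/
def baseCamera (k : Type*) [Field k] : Matrix (Fin 3) (Fin 4) k :=
  !![1, 0, 0, 0; 0, 1, 0, 0; 0, 0, 1, 0]

/-- A projection from the point `p` with `p 0 = 1`. -/
def sourceCamera (p : Fin 4 → k) : Matrix (Fin 3) (Fin 4) k :=
  !![p 1, -1, 0, 0; p 2, 0, -1, 0; -p 3, 0, 0, 1]

/-- The slope at `(0 : 0 : 1 : 0)` in the direction of `p`. -/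
def sigma (p : Fin 4 → k) : k := q.g + q.h * p 1

/-- The coefficient of y² in `p 3 * form₁ - sigma p * form₂`. It vanishes exactly when this quadric
contains x = z = 0, the tangent line of the curve at (0:0:0:1). -/
def beta (p : Fin 4 → k) : k := p 3 * q.f - q.sigma p * q.c

/-- The camera that is conjugate to `sourceCamera p`. -/
def targetCamera (p : Fin 4 → k) : Matrix (Fin 3) (Fin 4) k :=
  !![p 3, 0, -q.sigma p, 0;
    -(q.b + q.c * p 1), -q.c, q.f * p 1, -1;
    p 3 * q.e - q.sigma p * q.b + q.beta p * p 1, q.beta p, p 3 * q.h, 0]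

/-- `p` is an affine point of the curve. -/
structure OnCurve (p : Fin 4 → k) : Prop where
  affine : p 0 = 1
  zero₁ : q.form₁ p = 0
  zero₂ : q.form₂ p = 0

theorem baseCamera_mulVec (v : Fin 4 → k) : baseCamera k *ᵥ v = ![v 0, v 1, v 2] := by
  ext i
  fin_cases i <;> simp [baseCamera, Matrix.mulVec, dotProduct, Fin.sum_univ_four]

theorem sourceCamera_mulVec (p v : Fin 4 → k) : sourceCamera p *ᵥ v =
    ![p 1 * v 0 - v 1, p 2 * v 0 - v 2, v 3 - p 3 * v 0] := by
  ext i
  fin_cases i <;> simp [sourceCamera, Matrix.mulVec, dotProduct, Fin.sum_univ_four] <;> ring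

theorem targetCamera_mulVec (p v : Fin 4 → k) : q.targetCamera p *ᵥ v =
    ![p 3 * v 0 - q.sigma p * v 2,
      -(v 3 + (q.b + q.c * p 1) * v 0 + q.c * v 1 - q.f * p 1 * v 2),
      (p 3 * q.e - q.sigma p * q.b + q.beta p * p 1) * v 0 + q.beta p * v 1
        + p 3 * q.h * v 2] := by
  ext i
  fin_cases i <;> simp [targetCamera, Matrix.mulVec, dotProduct, Fin.sum_univ_four] <;> ring

/-- Solving the incidence conditions for `d` and `a` turns "the curve passes through p" into a
substitution, after which statements about p become polynomial identities. -/
theorem OnCurve.d_eq {q : QuarticCoeff k} {p : Fin 4 → k} (hp : q.OnCurve p) :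
    q.d = -(p 3 + q.e * p 1 + q.f * p 1 ^ 2 + q.sigma p * p 2) := by
  have h := hp.zero₁
  simp only [form₁, hp.affine] at h
  simp only [sigma]
  linear_combination h

theorem OnCurve.a_eq {q : QuarticCoeff k} {p : Fin 4 → k} (hp : q.OnCurve p) :
    q.a = -(p 3 * p 2 + q.b * p 1 + q.c * p 1 ^ 2) := by
  have h := hp.zero₂
  simp only [form₂, hp.affine] at h
  linear_combination h

/-- The image `(x : y : z : t)` of a point `(x : y : z : w)` of the curve satisfies a bilinear
equation in `t` and `w`. -/
theorem bilinear_relation {v : Fin 4 → k} {t : k} (h₁ : q.form₁ v = 0) (h₂ : q.form₂ v = 0)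
    (hv : v 0 ≠ 0 ∨ v 1 ≠ 0)
    (ht₀ : t * v 0 + v 2 * (q.e * v 0 + q.f * v 1 + q.h * v 2) = 0)
    (ht₁ : t * v 1 + (q.a * v 0 ^ 2 + q.b * v 0 * v 1 + q.c * v 1 ^ 2 - q.d * v 0 * v 2
      - q.g * v 2 ^ 2) = 0) :
    t * v 3 + q.c * v 3 * v 1 + q.c * q.d * v 0 * v 1 + q.c * q.g * v 1 * v 2
      - q.e * q.a * v 0 ^ 2 - q.e * q.b * v 0 * v 1
      - (q.f * v 1 + q.h * v 2) * (q.a * v 0 + q.b * v 1) = 0 := by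
  simp only [form₁, form₂] at h₁ h₂
  rcases hv with hv | hv
  · refine mul_left_cancel₀ hv ?_
    linear_combination v 3 * ht₀ + q.c * v 1 * h₁ - (q.e * v 0 + q.f * v 1 + q.h * v 2) * h₂
  · refine mul_left_cancel₀ hv ?_
    linear_combination v 3 * ht₁ - (q.a * v 0 + q.b * v 1 - q.d * v 2) * h₁
      + q.g * v 2 * h₂ + q.d * (v 0 * h₂ - v 2 * h₁)

/-- The first minor combines the two equations for t; the second does not involve t and is, up to
sign, the pencil member `p 3 * form₁ - sigma p * form₂`; only the third needs the bilinear relation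
between t and w. -/
theorem parallel_target {p v : Fin 4 → k} {t : k} (hp : q.OnCurve p)
    (h₁ : q.form₁ v = 0) (h₂ : q.form₂ v = 0) (hv : v 0 ≠ 0 ∨ v 1 ≠ 0)
    (ht₀ : t * v 0 + v 2 * (q.e * v 0 + q.f * v 1 + q.h * v 2) = 0)
    (ht₁ : t * v 1 + (q.a * v 0 ^ 2 + q.b * v 0 * v 1 + q.c * v 1 ^ 2 - q.d * v 0 * v 2
      - q.g * v 2 ^ 2) = 0) :
    Parallel (sourceCamera p *ᵥ v) (q.targetCamera p *ᵥ ![v 0, v 1, v 2, t]) := by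
  have hb := q.bilinear_relation h₁ h₂ hv ht₀ ht₁
  have hd := hp.d_eq
  have ha := hp.a_eq
  rw [sourceCamera_mulVec, targetCamera_mulVec]
  clear hp
  obtain ⟨a, b, c, d, e, f, g, h⟩ := q
  simp only [form₁, form₂, sigma, beta] at *
  subst ha hd
  apply parallel_of_minors <;> simp
  · linear_combination (-p 1) * ht₀ + ht₁
  · linear_combination (-p 3) * h₁ + (g + h * p 1) * h₂
  · linear_combination hb - p 3 * ht₀ + (b + c * p 1) * h₁ - f * p 1 * h₂

/-- Every point of the curve has a counterpart with the same images under the conjugate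
cameras. -/
theorem exists_conjugate_point {v : Fin 4 → k} (h₁ : q.form₁ v = 0)
    (h₂ : q.form₂ v = 0) :
    ∃ y : Fin 4 → k, y ≠ 0 ∧ Parallel (baseCamera k *ᵥ v) (baseCamera k *ᵥ y) ∧
      ∀ p, q.OnCurve p → Parallel (sourceCamera p *ᵥ v) (q.targetCamera p *ᵥ y) := by
  by_cases hv' : v 0 ≠ 0 ∨ v 1 ≠ 0
  -- The nonzero one of `v 0`, `v 1` determines t from its equation; the other equation then follows
  -- from x·form₂ − z·form₁ = 0, in which w cancels.
  · obtain ⟨t, ht₀, ht₁⟩ : ∃ t, t * v 0 + v 2 * (q.e * v 0 + q.f * v 1 + q.h * v 2) = 0 ∧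
        t * v 1 + (q.a * v 0 ^ 2 + q.b * v 0 * v 1 + q.c * v 1 ^ 2 - q.d * v 0 * v 2
          - q.g * v 2 ^ 2) = 0 := by
      simp only [form₁, form₂] at h₁ h₂
      rcases hv' with h | h
      · refine ⟨-(v 2 * (q.e * v 0 + q.f * v 1 + q.h * v 2)) / v 0, by field_simp; ring, ?_⟩
        field_simp
        linear_combination v 0 * h₂ - v 2 * h₁
      · refine ⟨-(q.a * v 0 ^ 2 + q.b * v 0 * v 1 + q.c * v 1 ^ 2 - q.d * v 0 * v 2
          - q.g * v 2 ^ 2) / v 1, ?_, by field_simp; ring⟩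
        field_simp
        linear_combination v 2 * h₁ - v 0 * h₂
    refine ⟨![v 0, v 1, v 2, t], ?_, ?_, fun p hp => q.parallel_target hp h₁ h₂ hv' ht₀ ht₁⟩
    · intro h
      rcases hv' with h' | h'
      · exact h' (congrFun h 0)
      · exact h' (congrFun h 1)
    · simp only [baseCamera_mulVec]
      exact fun i j => mul_comm _ _
  · push Not at hv'
    obtain ⟨hv₀, hv₁⟩ := hv'
    by_cases hv₂ : v 2 = 0
    -- The base centre (0:0:0:1) itself: its counterpart lies over its tangent direction (0:1:0),
    -- where ty + cy² = 0 gives t = −c.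
    · refine ⟨![0, 1, 0, -q.c], fun h => one_ne_zero (congrFun h 1), ?_, fun p hp => ?_⟩
      · rw [baseCamera_mulVec, baseCamera_mulVec]
        apply parallel_of_minors <;> simp [hv₀, hv₁, hv₂]
      · rw [sourceCamera_mulVec, targetCamera_mulVec]
        apply parallel_of_minors <;> simp [hv₀, hv₁, hv₂]
    · have hv₃ : v 3 = 0 := by
        simpa [form₂, hv₀, hv₁, hv₂] using h₂
      -- The auxiliary point (0:0:1:0) goes to the centre of the base camera, so its base image
      -- imposes no condition.
      refine ⟨![0, 0, 0, 1], fun h => one_ne_zero (congrFun h 3), ?_, fun p hp => ?_⟩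
      · rw [baseCamera_mulVec, baseCamera_mulVec]
        apply parallel_of_minors <;> simp
      · rw [sourceCamera_mulVec, targetCamera_mulVec]
        apply parallel_of_minors <;> simp [hv₀, hv₁, hv₃]

end Field
end QuarticCoeff
-- Nondegeneracy of the conjugate cameras.
namespace QuarticCoeff

variable {q : QuarticCoeff ℝ}

/-- The curve contains no line through `(0 : 0 : 0 : 1)`. -/
theorem c_ne_zero_or_f_ne_zero (hq : PrimePencil q.form₁ q.form₂) : q.c ≠ 0 ∨ q.f ≠ 0 := by
  by_contra! hcf
  obtain ⟨hc, hf⟩ := hcf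
  -- If c = f = 0, then x divides w·form₁ − hy·form₂, and the quotient contains w², a term that no
  -- member of the pencil has.
  rcases hq.prime ![1, 0, 0, 0]
    !![0, -q.h * q.a, 0, q.d; 0, -q.h * q.b, 0, q.e; 0, 0, 0, q.g; 0, 0, 0, 1]
    ![0, 0, 0, 1] ![0, -q.h, 0, 0] (fun v => by
      simp [quad, Matrix.mulVec, dotProduct, Fin.sum_univ_four, form₁, form₂, hc, hf]; ring)
    with h | ⟨α, β, h⟩
  · exact one_ne_zero (congrFun h 0)
  · have := h ![0, 0, 0, 1]
    simp [quad, Matrix.mulVec, dotProduct, Fin.sum_univ_four, form₁, form₂] at this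

/-- Otherwise the curve would contain the line joining p to (0:0:1:0), and the equation `p 1`·x − y
of its projection would divide the cubic x·form₂ − z·form₁. -/
theorem p_three_ne_zero_or_sigma_ne_zero (hq : PrimePencil q.form₁ q.form₂) {p : Fin 4 → ℝ}
    (hp : q.OnCurve p) : p 3 ≠ 0 ∨ q.sigma p ≠ 0 := by
  by_contra! h
  obtain ⟨hw, hs⟩ := h
  have ha := hp.a_eq
  have hd := hp.d_eq
  rw [hw, hs] at hd
  rw [hw] at ha
  have hg : q.g = -(q.h * p 1) := by
    rw [sigma] at hs
    linear_combination hs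
  rcases hq.prime ![p 1, -1, 0, 0]
    !![-q.b - q.c * p 1, -q.c, q.e + q.f * p 1, 0; 0, 0, q.f, 0; 0, 0, q.h, 0; 0, 0, 0, 0]
    ![0, 0, -1, 0] ![1, 0, 0, 0] (fun v => by
      simp [quad, Matrix.mulVec, dotProduct, Fin.sum_univ_four, form₁, form₂, ha, hd, hg]; ring)
    with h | ⟨α, β, h⟩
  · simpa using congrFun h 1
  -- The quotient is free of w, so the terms wx and wz force α = β = 0; the quotient is then zero,
  -- which kills `h`, `f` and `c`.
  · have e₁ := h ![1, 0, 0, 1]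
    have e₂ := h ![1, 0, 0, -1]
    have e₃ := h ![0, 0, 1, 1]
    have e₄ := h ![0, 0, 1, 0]
    have e₅ := h ![0, 1, 1, 0]
    have e₆ := h ![1, 1, 0, 0]
    have e₇ := h ![1, 0, 1, 0]
    have e₈ := h ![1, 0, 0, 0]
    simp [quad, Matrix.mulVec, dotProduct, Fin.sum_univ_four, form₁, form₂] at *
    have hα : α = 0 := by linarith
    have hβ : β = 0 := by linarith
    subst hα hβ
    have hh : q.h = 0 := by linarith
    have hf : q.f = 0 := by linarith
    have hc : q.c = 0 := by linarith
    rcases c_ne_zero_or_f_ne_zero hq with h | h <;> contradiction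

/-- The first and third rows of the conjugate camera are not proportional. -/
theorem targetCamera_rows (hq : PrimePencil q.form₁ q.form₂) {p : Fin 4 → ℝ} (hp : q.OnCurve p)
    (κ : ℝ) (h₀ : p 3 * q.e - q.sigma p * q.b + q.beta p * p 1 = κ * p 3) (h₁ : q.beta p = 0)
    (h₂ : p 3 * q.h = -κ * q.sigma p) : False := by
  have ha := hp.a_eq
  have hd := hp.d_eq
  -- Proportional rows would split a member of the pencil, with the first row of the camera as one
  -- factor.
  rcases hq.irred (p 3) (-q.sigma p) ![p 3, 0, -q.sigma p, 0] ![-p 3 - κ * p 1, κ, 0, 1]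
    (fun v => by
      simp only [form₁, form₂, ha, hd, Matrix.cons_val, dotProduct, Fin.sum_univ_four]
      simp only [beta, sigma] at *
      linear_combination (v 0 * (p 1 * v 0 - v 1)) * h₀ + (v 1 * (p 1 * v 0 - v 1)) * h₁
        + (v 2 * (p 1 * v 0 - v 1)) * h₂) with h | h
  · have := congrFun h 0
    have := congrFun h 2
    rcases p_three_ne_zero_or_sigma_ne_zero hq hp with h | h <;> simp_all
  · simpa using congrFun h 3

theorem targetCamera_vecMul_eq_zero (hq : PrimePencil q.form₁ q.form₂) {p : Fin 4 → ℝ}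
    (hp : q.OnCurve p) {r : Fin 3 → ℝ} (h : r ᵥ* q.targetCamera p = 0) : r = 0 := by
  have e₀ := congrFun h 0
  have e₁ := congrFun h 1
  have e₂ := congrFun h 2
  have e₃ := congrFun h 3
  simp [targetCamera, Matrix.vecMul, dotProduct, Fin.sum_univ_three] at e₀ e₁ e₂ e₃
  rw [e₃] at e₀ e₁ e₂
  have hr₂ : r 2 = 0 := by
    by_contra hr
    refine targetCamera_rows hq hp (-r 0 / r 2) ?_ ?_ ?_
    · field_simp
      linear_combination e₀
    · simpa [hr] using e₁
    · field_simp
      linear_combination e₂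
  have hr₀ : r 0 = 0 := by
    rcases p_three_ne_zero_or_sigma_ne_zero hq hp with h | h
    · simpa [hr₂, h] using e₀
    · simpa [hr₂, h] using e₂
  ext i
  fin_cases i <;> simp [hr₀, hr₂, e₃]

/-- If β vanishes, then (`p 3` : σ) = (c : f), so both centres select the same quadric of the
pencil. For f = 0 this makes x a factor of `form₁`; for f ≠ 0 the incidence conditions of the two
centres give a relation of coefficients (`hdet`) that makes the outer rows of the conjugate camera
proportional. -/
theorem not_beta_eq_zero (hq : PrimePencil q.form₁ q.form₂) {p p' : Fin 4 → ℝ}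
    (hp : q.OnCurve p) (hp' : q.OnCurve p') (hne : p 1 ≠ p' 1) (h : q.beta p = 0)
    (h' : q.beta p' = 0) : False := by
  have hs := p_three_ne_zero_or_sigma_ne_zero hq hp
  by_cases hf : q.f = 0
  · have hc : q.c ≠ 0 := by
      rcases c_ne_zero_or_f_ne_zero hq with h | h
      · exact h
      · exact absurd hf h
    simp [beta, hf, hc, sigma] at h h'
    have hh : q.h = 0 := by
      have : q.h * (p 1 - p' 1) = 0 := by linear_combination h - h'
      simpa [sub_ne_zero.2 hne] using this
    have hg : q.g = 0 := by simpa [hh] using h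
    rcases hq.irred 1 0 ![1, 0, 0, 0] ![q.d, q.e, 0, 1] (fun v => by
      simp [dotProduct, Fin.sum_univ_four, form₁, hf, hg, hh]; ring) with h | h
    · simpa using congrFun h 0
    · simpa using congrFun h 3
  · have hdet : q.b * q.f ^ 2 - q.e * q.f * q.c - q.h * q.c ^ 2 = 0 := by
      refine mul_left_cancel₀ (sub_ne_zero.2 hne) ?_
      have ha := hp.a_eq
      have ha' := hp'.a_eq
      have hd := hp.d_eq
      have hd' := hp'.d_eq
      simp only [beta, sigma] at *
      linear_combination q.f ^ 2 * (ha - ha') - q.f * q.c * (hd - hd')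
        + (q.c - q.f * p 2) * h - (q.c - q.f * p' 2) * h'
    have hw : p 3 = q.sigma p * q.c / q.f := by
      rw [beta] at h
      field_simp
      linear_combination h
    have hs' : q.sigma p ≠ 0 := by
      intro h0
      rcases hs with h | h
      · exact h (by rw [hw, h0]; simp)
      · exact h h0
    refine targetCamera_rows hq hp (-(q.h * q.c / q.f)) ?_ h ?_
    · rw [h, hw]
      field_simp
      linear_combination (-q.sigma p) * hdet
    · rw [hw]
      field_simp

theorem targetCamera_common_kernel (hq : PrimePencil q.form₁ q.form₂) {p p' : Fin 4 → ℝ}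
    (hp : q.OnCurve p) (hp' : q.OnCurve p') (hne : p 1 ≠ p' 1) {y : Fin 4 → ℝ}
    (h : q.targetCamera p *ᵥ y = 0) (h' : q.targetCamera p' *ᵥ y = 0) : y = 0 := by
  rw [targetCamera_mulVec] at h h'
  have e₀ := congrFun h 0
  have e₁ := congrFun h 1
  have e₂ := congrFun h 2
  have e₀' := congrFun h' 0
  have e₁' := congrFun h' 1
  have e₂' := congrFun h' 2
  simp only [Matrix.cons_val, Pi.zero_apply] at e₀ e₁ e₂ e₀' e₁' e₂'
  -- In the difference of the second rows `y 1` and `y 3` cancel, and the rest is divisible by `p 1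
  -- - p' 1`.
  have hcf : q.c * y 0 = q.f * y 2 := by
    refine mul_left_cancel₀ (sub_ne_zero.2 hne) ?_
    linear_combination e₁' - e₁
  have hβ : ∀ r : Fin 4 → ℝ, r 3 * y 0 - q.sigma r * y 2 = 0 →
      q.beta r * y 0 = 0 ∧ q.beta r * y 2 = 0 := fun r hr =>
    ⟨by rw [beta]; linear_combination q.f * hr - q.sigma r * hcf,
      by rw [beta]; linear_combination q.c * hr - r 3 * hcf⟩
  have hy : ∀ t : ℝ, q.beta p * t = 0 → q.beta p' * t = 0 → t = 0 := by
    intro t h h'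
    by_contra ht
    exact not_beta_eq_zero hq hp hp' hne (by simpa [ht] using h) (by simpa [ht] using h')
  have hy₀ : y 0 = 0 := hy _ (hβ p e₀).1 (hβ p' e₀').1
  have hy₂ : y 2 = 0 := hy _ (hβ p e₀).2 (hβ p' e₀').2
  rw [hy₀, hy₂] at e₁ e₂ e₂'
  have hy₁ : y 1 = 0 := hy _ (by linear_combination e₂) (by linear_combination e₂')
  have hy₃ : y 3 = 0 := by
    rw [hy₁] at e₁
    linear_combination -e₁
  ext i
  fin_cases i <;> simp [hy₀, hy₁, hy₂, hy₃]

/-- The curve contains no line joining two of its affine points. -/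
theorem not_line (hq : PrimePencil q.form₁ q.form₂) {p p' : Fin 4 → ℝ}
    (hp : q.OnCurve p) (hp' : q.OnCurve p') (hne : p 1 ≠ p' 1) (h₁ : q.form₁ (p - p') = 0)
    (h₂ : q.form₂ (p - p') = 0) : False := by
  have hΔ := sub_ne_zero.2 hne
  obtain ⟨ζ, hζ⟩ : ∃ ζ, p 2 - p' 2 = ζ * (p 1 - p' 1) := ⟨_, (div_mul_cancel₀ _ hΔ).symm⟩
  obtain ⟨η, hη⟩ : ∃ η, p 3 - p' 3 = η * (p 1 - p' 1) := ⟨_, (div_mul_cancel₀ _ hΔ).symm⟩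
  have ha := hp.a_eq
  have ha' := hp'.a_eq
  have hd := hp.d_eq
  have hd' := hp'.d_eq
  simp only [form₁, form₂, Pi.sub_apply, hp.affine, hp'.affine, sub_self, hζ, hη] at h₁ h₂
  have hf : q.f = -(q.h * ζ) := by
    refine mul_left_cancel₀ (pow_ne_zero 2 hΔ) ?_
    linear_combination h₁
  have hc : q.c = -(η * ζ) := by
    refine mul_left_cancel₀ (pow_ne_zero 2 hΔ) ?_
    linear_combination h₂
  have hp2 : p' 2 = p 2 - ζ * (p 1 - p' 1) := by linear_combination -hζ
  have hp3 : p' 3 = p 3 - η * (p 1 - p' 1) := by linear_combination -hη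
  simp only [sigma, hf, hc, hp2, hp3] at ha ha' hd hd'
  have he : q.e = -(η + q.g * ζ + q.h * (p 2 - ζ * p 1)) := by
    refine mul_left_cancel₀ hΔ ?_
    linear_combination hd - hd'
  have hb : q.b = -(η * (p 2 - ζ * p 1) + ζ * (p 3 - η * p 1)) := by
    refine mul_left_cancel₀ hΔ ?_
    linear_combination ha - ha'
  rw [he] at hd
  rw [hb] at ha
  -- With ζ, η the slopes of z and w along the line in terms of y, this linear form is the equation
  -- of its projection, which would divide the cubic z·form₁ − x·form₂.
  rcases hq.prime ![ζ * p 1 - p 2, -ζ, 1, 0]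
    !![-(p 3 - η * p 1), -η, q.g, 0; 0, 0, q.h, 0; 0, 0, 0, 0; 0, 0, 0, 0]
    ![0, 0, 1, 0] ![-1, 0, 0, 0] (fun v => by
      simp [quad, Matrix.mulVec, dotProduct, Fin.sum_univ_four, form₁, form₂, ha, hd, he, hb, hf,
        hc]
      ring)
    with h | ⟨α, β, h⟩
  · simpa using congrFun h 2
  · have e₁ := h ![1, 0, 0, 1]
    have e₂ := h ![1, 0, 0, -1]
    have e₃ := h ![0, 0, 1, 1]
    have e₄ := h ![0, 0, 1, 0]
    have e₅ := h ![0, 1, 1, 0]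
    have e₆ := h ![1, 1, 0, 0]
    have e₇ := h ![1, 0, 1, 0]
    have e₈ := h ![1, 0, 0, 0]
    simp [quad, Matrix.mulVec, dotProduct, Fin.sum_univ_four, form₁, form₂]
      at e₁ e₂ e₃ e₄ e₅ e₆ e₇ e₈
    have hα : α = 0 := by linarith
    have hβ : β = 0 := by linarith
    subst hα hβ
    have hh : q.h = 0 := by linarith
    have hη : η = 0 := by linarith
    rcases c_ne_zero_or_f_ne_zero hq with h | h
    · exact h (by rw [hc, hη]; simp)
    · exact h (by rw [hf, hh]; simp)

/-- The two images of v can correspond under the conjugate cameras only if v lies on the quadric `p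
3 * form₁ - sigma p * form₂`, a nonzero member of the pencil. Any v off this quadric will do. -/
theorem base_pair_nondegenerate (hq : PrimePencil q.form₁ q.form₂) {p : Fin 4 → ℝ}
    (hp : q.OnCurve p) : ∃ v : Fin 4 → ℝ, ∀ (y : Fin 4 → ℝ) (s t : ℝ),
      baseCamera ℝ *ᵥ y = s • baseCamera ℝ *ᵥ v →
      q.targetCamera p *ᵥ y = t • sourceCamera p *ᵥ v → y = 0 ∧ s = 0 ∧ t = 0 := by
  obtain ⟨v, hv⟩ : ∃ v, p 3 * q.form₁ v - q.sigma p * q.form₂ v ≠ 0 := by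
    by_contra! h
    have := hq.indep (p 3) (-q.sigma p) (fun v => by linear_combination h v)
    rcases p_three_ne_zero_or_sigma_ne_zero hq hp with h | h
    · exact h this.1
    · exact h (by linarith [this.2])
  refine ⟨v, fun y s t h h' => ?_⟩
  rw [baseCamera_mulVec, baseCamera_mulVec] at h
  rw [targetCamera_mulVec, sourceCamera_mulVec] at h'
  have e₀ := congrFun h 0
  have e₁ := congrFun h 1
  have e₂ := congrFun h 2
  have e₀' := congrFun h' 0
  have e₁' := congrFun h' 1
  have e₂' := congrFun h' 2
  simp only [Matrix.cons_val, Pi.smul_apply, smul_eq_mul] at e₀ e₁ e₂ e₀' e₁' e₂'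
  rw [e₀, e₂] at e₀'
  rw [e₀, e₁, e₂] at e₁' e₂'
  have ha := hp.a_eq
  have hd := hp.d_eq
  have hform : p 3 * q.form₁ v - q.sigma p * q.form₂ v =
      (p 3 * v 0 - q.sigma p * v 2) * (v 3 - p 3 * v 0) -
      ((p 3 * q.e - q.sigma p * q.b + q.beta p * p 1) * v 0 + q.beta p * v 1
        + p 3 * q.h * v 2) * (p 1 * v 0 - v 1) := by
    simp only [form₁, form₂, ha, hd, beta, sigma]
    ring
  have hs : s = 0 := by
    by_contra hs
    apply hv
    refine mul_left_cancel₀ hs ?_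
    rw [hform]
    linear_combination (v 3 - p 3 * v 0) * e₀' - (p 1 * v 0 - v 1) * e₂'
  have ht : t = 0 := by
    by_contra ht
    apply hv
    refine mul_left_cancel₀ ht ?_
    rw [hform]
    linear_combination
      ((p 3 * q.e - q.sigma p * q.b + q.beta p * p 1) * v 0 + q.beta p * v 1
        + p 3 * q.h * v 2) * e₀' - (p 3 * v 0 - q.sigma p * v 2) * e₂'
  subst hs ht
  refine ⟨?_, rfl, rfl⟩
  ext i
  fin_cases i
  · simpa using e₀
  · simpa using e₁
  · simpa using e₂
  · simpa using e₁'

/-- Eliminating `y 1` and `y 3` leaves a 4 × 4 system `N v` in (`y 0`, `y 2`, s, t), so a v with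
nonzero determinant suffices. A determinant vanishing identically would give either two centres with
β = 0 or a line of the curve through p and p'. -/
theorem pair_nondegenerate (hq : PrimePencil q.form₁ q.form₂) {p p' : Fin 4 → ℝ}
    (hp : q.OnCurve p) (hp' : q.OnCurve p') (hne : p 1 ≠ p' 1) :
    ∃ v : Fin 4 → ℝ, ∀ (y : Fin 4 → ℝ) (s t : ℝ),
      q.targetCamera p *ᵥ y = s • sourceCamera p *ᵥ v →
      q.targetCamera p' *ᵥ y = t • sourceCamera p' *ᵥ v → y = 0 ∧ s = 0 ∧ t = 0 := by
  let ε : (Fin 4 → ℝ) → ℝ := fun r => r 3 * q.e - q.sigma r * q.b + q.beta r * r 1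
  let N : (Fin 4 → ℝ) → Matrix (Fin 4) (Fin 4) ℝ := fun v =>
    !![p 3, -q.sigma p, -(p 1 * v 0 - v 1), 0;
      p' 3, -q.sigma p', 0, -(p' 1 * v 0 - v 1);
      q.c * (p 1 - p' 1), -(q.f * (p 1 - p' 1)), p 2 * v 0 - v 2, -(p' 2 * v 0 - v 2);
      q.beta p' * ε p - q.beta p * ε p', q.h * (q.beta p' * p 3 - q.beta p * p' 3),
        -(q.beta p' * (v 3 - p 3 * v 0)), q.beta p * (v 3 - p' 3 * v 0)]
  obtain ⟨v, hv⟩ : ∃ v, (N v).det ≠ 0 := by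
    by_contra! hN
    have e₁ := hN ![0, 0, 1, 1]
    have e₂ := hN ![1, p 1, 0, 1]
    have e₃ := hN ![1, p 1, 0, 0]
    simp [N, Matrix.det_succ_row_zero, Fin.sum_univ_succ, Fin.succAbove] at e₁ e₂ e₃
    have hΔ := sub_ne_zero.2 hne
    have h₁ : (p 3 * q.sigma p' - p' 3 * q.sigma p) * (q.beta p - q.beta p') = 0 := by
      linear_combination e₁
    have h₂ : q.beta p * q.beta p' * (p 1 - p' 1) ^ 2 =
        (p 3 * q.sigma p' - p' 3 * q.sigma p) * (p 2 * q.beta p - p' 2 * q.beta p') := by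
      have hβ : q.beta p = p 3 * q.f - q.sigma p * q.c := rfl
      linear_combination e₂ - e₃ + q.beta p' * (p 1 - p' 1) ^ 2 * hβ
    -- In the first case (`p 3` : σ) agrees for both centres, so one vanishing β forces the other.
    -- In the second the common β is nonzero, and both forms vanish at p − p'.
    rcases mul_eq_zero.1 h₁ with hω | hβ
    · rw [hω, zero_mul] at h₂
      have aux : ∀ r r' : Fin 4 → ℝ, q.OnCurve r → r 3 * q.sigma r' - r' 3 * q.sigma r = 0 →
          q.beta r = 0 → q.beta r' = 0 := by
        intro r r' hr hω h
        simp only [beta] at h ⊢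
        rcases p_three_ne_zero_or_sigma_ne_zero hq hr with h0 | h0
        · refine mul_left_cancel₀ h0 ?_
          linear_combination r' 3 * h - q.c * hω
        · refine mul_left_cancel₀ h0 ?_
          linear_combination q.sigma r' * h - q.f * hω
      rcases mul_eq_zero.1 ((mul_eq_zero.1 h₂).resolve_right (pow_ne_zero 2 hΔ)) with h | h
      · exact not_beta_eq_zero hq hp hp' hne h (aux p p' hp hω h)
      · exact not_beta_eq_zero hq hp hp' hne
          (aux p' p hp' (by linear_combination -hω) h) h
    · have hβ' : q.beta p' = q.beta p := by linear_combination -hβ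
      rw [hβ'] at h₂
      have h0 : q.beta p ≠ 0 := fun h => not_beta_eq_zero hq hp hp' hne h (hβ'.trans h)
      have h₃ : q.beta p * (p 1 - p' 1) ^ 2 =
          (p 3 * q.sigma p' - p' 3 * q.sigma p) * (p 2 - p' 2) := by
        refine mul_left_cancel₀ h0 ?_
        linear_combination h₂
      have hf : q.f * (p 3 * q.sigma p' - p' 3 * q.sigma p)
          = -(q.beta p * (q.h * (p 1 - p' 1))) := by
        have : q.f * (p 3 * q.sigma p' - p' 3 * q.sigma p)
            = q.beta p * q.sigma p' - q.beta p' * q.sigma p := by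
          simp only [beta]
          ring
        rw [this, hβ', sigma, sigma]
        ring
      have hc : q.c * (p 3 * q.sigma p' - p' 3 * q.sigma p) = -(q.beta p * (p 3 - p' 3)) := by
        have : q.c * (p 3 * q.sigma p' - p' 3 * q.sigma p)
            = q.beta p * p' 3 - q.beta p' * p 3 := by
          simp only [beta]
          ring
        rw [this, hβ']
        ring
      refine not_line hq hp hp' hne ?_ ?_
      · refine mul_left_cancel₀ h0 ?_
        simp only [form₁, Pi.sub_apply, hp.affine, hp'.affine]
        linear_combination q.f * h₃ + (p 2 - p' 2) * hf
      · refine mul_left_cancel₀ h0 ?_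
        simp only [form₂, Pi.sub_apply, hp.affine, hp'.affine]
        linear_combination q.c * h₃ + (p 2 - p' 2) * hc
  refine ⟨v, fun y s t h h' => ?_⟩
  rw [targetCamera_mulVec, sourceCamera_mulVec] at h h'
  have e₀ := congrFun h 0
  have e₁ := congrFun h 1
  have e₂ := congrFun h 2
  have e₀' := congrFun h' 0
  have e₁' := congrFun h' 1
  have e₂' := congrFun h' 2
  simp only [Matrix.cons_val, Pi.smul_apply, smul_eq_mul] at e₀ e₁ e₂ e₀' e₁' e₂'
  have hker : N v *ᵥ ![y 0, y 2, s, t] = 0 := by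
    ext i
    fin_cases i
    · simp [N, Matrix.mulVec, dotProduct, Fin.sum_univ_four]
      linear_combination e₀
    · simp [N, Matrix.mulVec, dotProduct, Fin.sum_univ_four]
      linear_combination e₀'
    · simp [N, Matrix.mulVec, dotProduct, Fin.sum_univ_four]
      linear_combination e₁' - e₁
    · simp [N, Matrix.mulVec, dotProduct, Fin.sum_univ_four, ε]
      linear_combination q.beta p' * e₂ - q.beta p * e₂'
  have hz : ![y 0, y 2, s, t] = 0 := by
    by_contra h0
    exact hv (Matrix.exists_mulVec_eq_zero_iff.1 ⟨_, h0, hker⟩)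
  have hs : s = 0 := congrFun hz 2
  have ht : t = 0 := congrFun hz 3
  subst hs ht
  refine ⟨targetCamera_common_kernel hq hp hp' hne ?_ ?_, rfl, rfl⟩
  · rw [targetCamera_mulVec, h, zero_smul]
  · rw [targetCamera_mulVec, h', zero_smul]

end QuarticCoeff

/-! ### The prime ideal in low degrees and its real consequences. -/

open MvPolynomial in
-- Used with φ quadratic: in degree one nothing of ψφ survives, and in degree two only the constant
-- term of ψ contributes.
theorem homogeneousComponent_mul_of_isHomogeneous {R : Type*} [CommRing R]
    {φ : MvPolynomial (Fin 4) R} {m : ℕ} (hφ : φ.IsHomogeneous m) (ψ : MvPolynomial (Fin 4) R)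
    (n : ℕ) : homogeneousComponent n (ψ * φ) =
      ∑ i ∈ Finset.range (ψ.totalDegree + 1),
        if i + m = n then homogeneousComponent i ψ * φ else 0 := by
  conv_lhs => rw [← sum_homogeneousComponent ψ, Finset.sum_mul, map_sum]
  refine Finset.sum_congr rfl fun i _ => ?_
  have h := (homogeneousComponent_isHomogeneous i ψ).mul hφ
  rw [homogeneousComponent_of_mem h]
  simp only [eq_comm]

section ideal

open MvPolynomial

variable {q₁ q₂ : MvPolynomial (Fin 4) ℂ}

theorem eq_zero_of_mem_span_pair (h₁ : q₁.IsHomogeneous 2) (h₂ : q₂.IsHomogeneous 2)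
    {p : MvPolynomial (Fin 4) ℂ} (hp : p.IsHomogeneous 1) (h : p ∈ Ideal.span {q₁, q₂}) :
    p = 0 := by
  obtain ⟨a, b, rfl⟩ := Ideal.mem_span_pair.1 h
  rw [← homogeneousComponent_eq_self hp, map_add, homogeneousComponent_mul_of_isHomogeneous h₁,
    homogeneousComponent_mul_of_isHomogeneous h₂]
  simp

theorem exists_of_mem_span_pair (h₁ : q₁.IsHomogeneous 2) (h₂ : q₂.IsHomogeneous 2)
    {p : MvPolynomial (Fin 4) ℂ} (hp : p.IsHomogeneous 2) (h : p ∈ Ideal.span {q₁, q₂}) :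
    ∃ α β : ℂ, p = C α * q₁ + C β * q₂ := by
  obtain ⟨a, b, rfl⟩ := Ideal.mem_span_pair.1 h
  refine ⟨coeff 0 a, coeff 0 b, ?_⟩
  conv_lhs => rw [← homogeneousComponent_eq_self hp, map_add,
    homogeneousComponent_mul_of_isHomogeneous h₁, homogeneousComponent_mul_of_isHomogeneous h₂]
  simp [homogeneousComponent_zero]

end ideal

section polynomials

open MvPolynomial

/-- The linear form with coefficient vector `a`. -/
noncomputable def linearPoly (a : Fin 4 → ℝ) : MvPolynomial (Fin 4) ℝ := ∑ i, C (a i) * X i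

/-- The quadratic form with matrix `S`. -/
noncomputable def quadPoly (S : Matrix (Fin 4) (Fin 4) ℝ) : MvPolynomial (Fin 4) ℝ :=
  ∑ i, ∑ j, C (S i j) * (X i * X j)

theorem isHomogeneous_linearPoly (a : Fin 4 → ℝ) : (linearPoly a).IsHomogeneous 1 :=
  IsHomogeneous.sum _ _ _ fun i _ => (isHomogeneous_X _ i).C_mul _

theorem isHomogeneous_quadPoly (S : Matrix (Fin 4) (Fin 4) ℝ) : (quadPoly S).IsHomogeneous 2 :=
  IsHomogeneous.sum _ _ _ fun i _ => IsHomogeneous.sum _ _ _ fun j _ =>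
    ((isHomogeneous_X _ i).mul (isHomogeneous_X _ j)).C_mul _

theorem aeval_linearPoly {k : Type*} [Field k] [Algebra ℝ k] (a : Fin 4 → ℝ) (v : Fin 4 → k) :
    aeval v (linearPoly a) = (algebraMap ℝ k ∘ a) ⬝ᵥ v := by
  simp [linearPoly, dotProduct]

theorem aeval_quadPoly {k : Type*} [Field k] [Algebra ℝ k] (S : Matrix (Fin 4) (Fin 4) ℝ)
    (v : Fin 4 → k) : aeval v (quadPoly S) = quad (S.map (algebraMap ℝ k)) v := by
  simp only [quadPoly, quad, dotProduct, Matrix.mulVec, map_sum, map_mul, aeval_X, aeval_C,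
    Matrix.map_apply, Finset.mul_sum]
  exact Finset.sum_congr rfl fun i _ => Finset.sum_congr rfl fun j _ => by ring

theorem eval_linearPoly (a v : Fin 4 → ℝ) : eval v (linearPoly a) = a ⬝ᵥ v := by
  simpa [aeval_eq_eval] using aeval_linearPoly a v

theorem eval_quadPoly (S : Matrix (Fin 4) (Fin 4) ℝ) (v : Fin 4 → ℝ) :
    eval v (quadPoly S) = quad S v := by
  simpa [aeval_eq_eval, Matrix.map_id'] using aeval_quadPoly S v

theorem eq_zero_of_linearPoly_eq_zero {a : Fin 4 → ℝ} (h : linearPoly a = 0) : a = 0 := by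
  ext i
  have := eval_linearPoly a (Pi.single i 1)
  simpa [h] using this.symm

theorem pderiv_comm (i j : Fin 4) (φ : MvPolynomial (Fin 4) ℝ) :
    pderiv i (pderiv j φ) = pderiv j (pderiv i φ) := by
  have h : ⁅pderiv (R := ℝ) i, pderiv (R := ℝ) j⁆ = 0 := by
    apply MvPolynomial.derivation_ext
    intro k
    rw [Derivation.commutator_apply, pderiv_X, pderiv_X]
    simp only [Pi.single_apply]
    split_ifs <;> simp
  have := congrArg (fun D => D φ) h
  simpa [Derivation.commutator_apply, sub_eq_zero] using this

/-- A real quadratic form is given by a symmetric matrix. -/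
theorem exists_eq_quadPoly {φ : MvPolynomial (Fin 4) ℝ} (hφ : φ.IsHomogeneous 2) :
    ∃ M : Matrix (Fin 4) (Fin 4) ℝ, M.IsSymm ∧ φ = quadPoly M ∧
      ∀ i, pderiv i φ = linearPoly (2 • M i) := by
  -- The second derivatives are constants, and Euler's identity applied twice recovers φ from them;
  -- the matrix is half the Hessian.
  have h0 : ∀ i j, pderiv j (pderiv i φ) = C (coeff 0 (pderiv j (pderiv i φ))) := fun i j =>
    totalDegree_eq_zero_iff_eq_C.1 ((totalDegree_zero_iff_isHomogeneous _).2 hφ.pderiv.pderiv)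
  have h1 : ∀ i, pderiv i φ = ∑ j, X j * C (coeff 0 (pderiv j (pderiv i φ))) := by
    intro i
    have := (hφ.pderiv (i := i)).sum_X_mul_pderiv
    simp only [← h0]
    simpa using this.symm
  have h2 := hφ.sum_X_mul_pderiv
  refine ⟨Matrix.of fun i j => coeff 0 (pderiv j (pderiv i φ)) / 2, ?_, ?_, fun i => ?_⟩
  · ext i j
    simp only [Matrix.transpose_apply, Matrix.of_apply]
    rw [pderiv_comm]
  · have h3 : (2 : MvPolynomial (Fin 4) ℝ) * φ = 2 * quadPoly
        (Matrix.of fun i j => coeff 0 (pderiv j (pderiv i φ)) / 2) := by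
      rw [two_mul, ← two_nsmul, ← h2, quadPoly, Finset.mul_sum]
      refine Finset.sum_congr rfl fun i _ => ?_
      rw [h1 i, Finset.mul_sum, Finset.mul_sum]
      refine Finset.sum_congr rfl fun j _ => ?_
      have : (C (coeff 0 (pderiv j (pderiv i φ))) : MvPolynomial (Fin 4) ℝ) =
          2 * C (coeff 0 (pderiv j (pderiv i φ)) / 2) := by
        rw [show (2 : MvPolynomial (Fin 4) ℝ) = C 2 from (map_ofNat C 2).symm, ← C_mul]
        congr 1
        ring
      simp only [Matrix.of_apply]
      rw [this]
      ring
    exact mul_left_cancel₀ two_ne_zero h3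
  · conv_lhs => rw [h1 i]
    rw [linearPoly]
    refine Finset.sum_congr rfl fun j _ => ?_
    rw [mul_comm]
    congr 2
    simp
    ring

end polynomials

open MvPolynomial in
theorem primePencil_of_isIrreducibleQuartic {M₁ M₂ : Matrix (Fin 4) (Fin 4) ℝ}
    (h : IsIrreducibleQuartic (quadPoly M₁) (quadPoly M₂)) :
    PrimePencil (quad M₁) (quad M₂) := by
  have hinj := MvPolynomial.map_injective (σ := Fin 4) _ (algebraMap ℝ ℂ).injective
  have hom₁ := h.homogeneous_left.map (algebraMap ℝ ℂ)
  have hom₂ := h.homogeneous_right.map (algebraMap ℝ ℂ)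
  have hlin : ∀ a : Fin 4 → ℝ, MvPolynomial.map (algebraMap ℝ ℂ) (linearPoly a) ∈
      Ideal.span {MvPolynomial.map (algebraMap ℝ ℂ) (quadPoly M₁),
        MvPolynomial.map (algebraMap ℝ ℂ) (quadPoly M₂)} → a = 0 := fun a ha =>
    eq_zero_of_linearPoly_eq_zero (hinj (by
      rw [eq_zero_of_mem_span_pair hom₁ hom₂ ((isHomogeneous_linearPoly a).map _) ha, map_zero]))
  refine ⟨fun α β hv => ?_, fun α β a b hv => ?_, fun a S m₁ m₂ hv => ?_⟩
  · have h0 : α • quadPoly M₁ + β • quadPoly M₂ = 0 := by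
      apply MvPolynomial.funext
      intro v
      simpa [eval_quadPoly, smul_eval] using hv v
    exact LinearIndependent.pair_iff.1 h.linearIndependent α β h0
  · have h0 : linearPoly a * linearPoly b = C α * quadPoly M₁ + C β * quadPoly M₂ := by
      apply MvPolynomial.funext
      intro v
      simpa [eval_quadPoly, eval_linearPoly] using hv v
    have h1 : MvPolynomial.map (algebraMap ℝ ℂ) (linearPoly a) *
        MvPolynomial.map (algebraMap ℝ ℂ) (linearPoly b) ∈ Ideal.span
        {MvPolynomial.map (algebraMap ℝ ℂ) (quadPoly M₁),
          MvPolynomial.map (algebraMap ℝ ℂ) (quadPoly M₂)} := by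
      rw [← map_mul, h0, map_add, map_mul, map_mul]
      exact Ideal.mem_span_pair.2 ⟨_, _, rfl⟩
    exact (h.isPrime.mem_or_mem h1).imp (hlin a) (hlin b)
  · have h0 : linearPoly a * quadPoly S =
        linearPoly m₁ * quadPoly M₁ + linearPoly m₂ * quadPoly M₂ := by
      apply MvPolynomial.funext
      intro v
      simpa [eval_quadPoly, eval_linearPoly] using hv v
    have h1 : MvPolynomial.map (algebraMap ℝ ℂ) (linearPoly a) *
        MvPolynomial.map (algebraMap ℝ ℂ) (quadPoly S) ∈ Ideal.span
        {MvPolynomial.map (algebraMap ℝ ℂ) (quadPoly M₁),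
          MvPolynomial.map (algebraMap ℝ ℂ) (quadPoly M₂)} := by
      rw [← map_mul, h0, map_add, map_mul, map_mul]
      exact Ideal.mem_span_pair.2 ⟨_, _, rfl⟩
    refine (h.isPrime.mem_or_mem h1).imp (hlin a) fun hS => ?_
    obtain ⟨α, β, hαβ⟩ :=
      exists_of_mem_span_pair hom₁ hom₂ ((isHomogeneous_quadPoly S).map _) hS
    -- At real vectors all three forms take real values, so the complex coefficients may be replaced
    -- by their real parts.
    refine ⟨α.re, β.re, fun v => ?_⟩
    have key : ∀ T : Matrix (Fin 4) (Fin 4) ℝ,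
        eval (algebraMap ℝ ℂ ∘ v) (MvPolynomial.map (algebraMap ℝ ℂ) (quadPoly T)) =
          ((quad T v : ℝ) : ℂ) := by
      intro T
      rw [eval_map, ← eval₂_comp, eval_quadPoly]
      rfl
    have := congrArg (eval (algebraMap ℝ ℂ ∘ v)) hαβ
    rw [map_add, map_mul, map_mul, key, key, key, eval_C, eval_C] at this
    simpa using congrArg Complex.re this


/-! ### Change of coordinates and of generators. -/

section transport

theorem quad_mulVec {k : Type*} [Field k] (S U : Matrix (Fin 4) (Fin 4) k) (v : Fin 4 → k) :
    quad S (U *ᵥ v) = quad (Uᵀ * S * U) v := by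
  simp only [quad, ← Matrix.mulVec_mulVec]
  rw [Matrix.dotProduct_mulVec v Uᵀ, Matrix.vecMul_transpose]

/-- The pencil condition does not depend on the coordinates. -/
theorem PrimePencil.comp {q₁ q₂ : (Fin 4 → ℝ) → ℝ} (h : PrimePencil q₁ q₂)
    {U : Matrix (Fin 4) (Fin 4) ℝ} (hU : IsUnit U) :
    PrimePencil (fun v => q₁ (U *ᵥ v)) (fun v => q₂ (U *ᵥ v)) := by
  obtain ⟨V, hUV, hVU⟩ : ∃ V : Matrix (Fin 4) (Fin 4) ℝ, U * V = 1 ∧ V * U = 1 :=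
    ⟨U⁻¹, Matrix.mul_nonsing_inv _ ((Matrix.isUnit_iff_isUnit_det _).1 hU),
      Matrix.nonsing_inv_mul _ ((Matrix.isUnit_iff_isUnit_det _).1 hU)⟩
  have hU' : ∀ v, U *ᵥ (V *ᵥ v) = v := fun v => by
    rw [Matrix.mulVec_mulVec, hUV, Matrix.one_mulVec]
  have hV' : ∀ v, V *ᵥ (U *ᵥ v) = v := fun v => by
    rw [Matrix.mulVec_mulVec, hVU, Matrix.one_mulVec]
  have hz : ∀ a : Fin 4 → ℝ, a ᵥ* V = 0 → a = 0 := fun a ha => by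
    have : (a ᵥ* V) ᵥ* U = a := by rw [Matrix.vecMul_vecMul, hVU, Matrix.vecMul_one]
    rw [← this, ha, Matrix.zero_vecMul]
  refine ⟨fun α β hv => h.indep α β fun v => ?_, fun α β a b hv => ?_, fun a S m₁ m₂ hv => ?_⟩
  · simpa [hU'] using hv (V *ᵥ v)
  · refine (h.irred α β (a ᵥ* V) (b ᵥ* V) fun v => ?_).imp (hz a) (hz b)
    simpa [hU', Matrix.dotProduct_mulVec] using hv (V *ᵥ v)
  · refine (h.prime (a ᵥ* V) (Vᵀ * S * V) (m₁ ᵥ* V) (m₂ ᵥ* V) fun v => ?_).imp (hz a) ?_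
    · simpa [hU', Matrix.dotProduct_mulVec, quad_mulVec] using hv (V *ᵥ v)
    · rintro ⟨α, β, h⟩
      refine ⟨α, β, fun v => ?_⟩
      rw [← h, ← quad_mulVec, hV']

/-- The pencil condition is invariant under a triangular change of generators. -/
theorem PrimePencil.change {q₁ q₂ : (Fin 4 → ℝ) → ℝ} (h : PrimePencil q₁ q₂) {s : ℝ} (hs : s ≠ 0)
    (t : ℝ) : PrimePencil (fun v => s * q₁ v + t * q₂ v) (fun v => s⁻¹ * q₂ v) := by
  refine ⟨fun α β hv => ?_, fun α β a b hv => ?_, fun a S m₁ m₂ hv => ?_⟩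
  · obtain ⟨h₁, h₂⟩ := h.indep (α * s) (α * t + β * s⁻¹) fun v => by linear_combination hv v
    have hα : α = 0 := by simpa [hs] using h₁
    exact ⟨hα, by simpa [hα, hs] using h₂⟩
  · exact h.irred (α * s) (α * t + β * s⁻¹) a b fun v => by rw [hv v]; ring
  · refine (h.prime a S (s • m₁) (t • m₁ + s⁻¹ • m₂) fun v => ?_).imp_right ?_
    · rw [hv v]
      simp only [smul_dotProduct, add_dotProduct, smul_eq_mul]
      ring
    · rintro ⟨α, β, h⟩
      refine ⟨α * s⁻¹, s * (β - α * s⁻¹ * t), fun v => ?_⟩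
      rw [h v]
      field_simp
      ring

end transport

/-! ### Real points of plane cubics. -/

section cubic

theorem exists_root_cubic {k : ℝ} (hk : k ≠ 0) (l m r : ℝ) :
    ∃ x : ℝ, k * x ^ 3 + l * x ^ 2 + m * x + r = 0 := by
  suffices H : ∀ l m r : ℝ, ∃ x : ℝ, x ^ 3 + l * x ^ 2 + m * x + r = 0 by
    obtain ⟨x, hx⟩ := H (l / k) (m / k) (r / k)
    refine ⟨x, ?_⟩
    field_simp at hx
    linear_combination hx
  intro l m r
  -- At ±B the cubic term dominates, so the polynomial changes sign on [−B, B].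
  set B := 1 + |l| + |m| + |r| with hB
  have hl := abs_le.1 (le_refl |l|)
  have hm := abs_le.1 (le_refl |m|)
  have hr := abs_le.1 (le_refl |r|)
  have hl₀ := abs_nonneg l
  have hm₀ := abs_nonneg m
  have hr₀ := abs_nonneg r
  have h1 : 1 ≤ B := by linarith
  have hBB : B ≤ B ^ 2 := by nlinarith
  have e₁ : |m| * B ≤ |m| * B ^ 2 := mul_le_mul_of_nonneg_left hBB hm₀
  have e₂ : |r| ≤ |r| * B ^ 2 := le_mul_of_one_le_right hr₀ (by linarith)
  have e₃ : B ^ 3 = B ^ 2 + |l| * B ^ 2 + |m| * B ^ 2 + |r| * B ^ 2 := by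
    rw [pow_succ, mul_comm]
    nth_rw 1 [hB]
    ring
  have e₄ : |l * B ^ 2| = |l| * B ^ 2 := by rw [abs_mul, abs_of_nonneg (sq_nonneg B)]
  have e₅ : |m * B| = |m| * B := by rw [abs_mul, abs_of_nonneg (by linarith : 0 ≤ B)]
  have f₄ := abs_le.1 e₄.le
  have f₅ := abs_le.1 e₅.le
  have hcont : ContinuousOn (fun x : ℝ => x ^ 3 + l * x ^ 2 + m * x + r) (Set.Icc (-B) B) := by
    fun_prop
  obtain ⟨x, -, hx⟩ := intermediate_value_Icc (by linarith : -B ≤ B) hcont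
    (show (0 : ℝ) ∈ Set.Icc _ _ from ⟨by ring_nf at *; linarith, by linarith⟩)
  exact ⟨x, hx⟩

theorem cubic_coeff_eq_zero {c₀ c₁ c₂ c₃ : ℝ}
    (h : {t : ℝ | c₀ + c₁ * t + c₂ * t ^ 2 + c₃ * t ^ 3 = 0}.Infinite) :
    c₀ = 0 ∧ c₁ = 0 ∧ c₂ = 0 ∧ c₃ = 0 := by
  open Polynomial in
  have hp : (C c₀ + C c₁ * X + C c₂ * X ^ 2 + C c₃ * X ^ 3 : ℝ[X]) = 0 := by
    apply Polynomial.eq_zero_of_infinite_isRoot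
    convert h using 3
    simp [Polynomial.IsRoot]
  refine ⟨?_, ?_, ?_, ?_⟩
  · simpa [Polynomial.coeff_X, Polynomial.coeff_C] using congrArg (Polynomial.coeff · 0) hp
  · simpa [Polynomial.coeff_X, Polynomial.coeff_C, Polynomial.coeff_X_pow]
      using congrArg (Polynomial.coeff · 1) hp
  · simpa [Polynomial.coeff_X, Polynomial.coeff_C, Polynomial.coeff_X_pow]
      using congrArg (Polynomial.coeff · 2) hp
  · simpa [Polynomial.coeff_X, Polynomial.coeff_C, Polynomial.coeff_X_pow]
      using congrArg (Polynomial.coeff · 3) hp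

/-- A real plane cubic that contains none of finitely many lines has a real point outside these
lines. -/
theorem exists_cubic_point {k l₀ l₁ m₀ m₁ m₂ r₀ r₁ r₂ r₃ : ℝ} (hk : k ≠ 0)
    (Λ : Finset (Fin 4 → ℝ)) (hΛ : ∀ a ∈ Λ, a ≠ 0) (hΛ₃ : ∀ a ∈ Λ, a 3 = 0)
    (hdiv : ∀ a ∈ Λ, ∀ s t : ℝ, a 0 = -(a 2 * s) → a 1 = -(a 2 * t) →
      ¬ ∀ x y : ℝ, k * (s * x + t * y) ^ 3 + (l₀ * x + l₁ * y) * (s * x + t * y) ^ 2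
        + (m₀ * x ^ 2 + m₁ * x * y + m₂ * y ^ 2) * (s * x + t * y)
        + (r₀ * x ^ 3 + r₁ * x ^ 2 * y + r₂ * x * y ^ 2 + r₃ * y ^ 3) = 0) :
    ∃ x y z : ℝ, k * z ^ 3 + (l₀ * x + l₁ * y) * z ^ 2
        + (m₀ * x ^ 2 + m₁ * x * y + m₂ * y ^ 2) * z
        + (r₀ * x ^ 3 + r₁ * x ^ 2 * y + r₂ * x * y ^ 2 + r₃ * y ^ 3) = 0 ∧
      ∀ a ∈ Λ, a 0 * x + a 1 * y + a 2 * z ≠ 0 := by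
  -- Every slope t has a real point (1 : t : c t) on the cubic. If finitely many lines covered all
  -- of them, one line would contain infinitely many and hence be a component.
  choose c hc using fun t : ℝ => exists_root_cubic hk (l₀ + l₁ * t) (m₀ + m₁ * t + m₂ * t ^ 2)
    (r₀ + r₁ * t + r₂ * t ^ 2 + r₃ * t ^ 3)
  by_contra! hcon
  have hcov : (⋃ a ∈ Λ, {t : ℝ | a 0 + a 1 * t + a 2 * c t = 0}) = Set.univ := by
    refine Set.eq_univ_of_forall fun t => ?_
    obtain ⟨a, ha, h⟩ := hcon 1 t (c t) (by linear_combination hc t)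
    exact Set.mem_biUnion ha (by simpa using h)
  obtain ⟨a, ha, hinf⟩ : ∃ a ∈ Λ, {t : ℝ | a 0 + a 1 * t + a 2 * c t = 0}.Infinite := by
    by_contra! hfin
    refine Set.infinite_univ (α := ℝ) ?_
    rw [← hcov]
    exact Λ.finite_toSet.biUnion hfin
  by_cases ha₂ : a 2 = 0
  · obtain ⟨h₀, h₁, -, -⟩ := cubic_coeff_eq_zero (c₀ := a 0) (c₁ := a 1) (c₂ := 0) (c₃ := 0)
      (hinf.mono fun t ht => by simpa [ha₂] using ht)
    refine hΛ a ha ?_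
    ext i
    fin_cases i <;> simp [h₀, h₁, ha₂, hΛ₃ a ha]
  · obtain ⟨s, hs⟩ : ∃ s, a 0 = -(a 2 * s) := ⟨-(a 0 / a 2), by field_simp⟩
    obtain ⟨u, hu⟩ : ∃ u, a 1 = -(a 2 * u) := ⟨-(a 1 / a 2), by field_simp⟩
    obtain ⟨h₀, h₁, h₂, h₃⟩ := cubic_coeff_eq_zero
      (c₀ := k * s ^ 3 + l₀ * s ^ 2 + m₀ * s + r₀)
      (c₁ := 3 * k * s ^ 2 * u + 2 * l₀ * s * u + l₁ * s ^ 2 + m₀ * u + m₁ * s + r₁)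
      (c₂ := 3 * k * s * u ^ 2 + l₀ * u ^ 2 + 2 * l₁ * s * u + m₁ * u + m₂ * s + r₂)
      (c₃ := k * u ^ 3 + l₁ * u ^ 2 + m₂ * u + r₃)
      (hinf.mono fun t ht => by
        have hct : c t = s + u * t := by
          refine mul_left_cancel₀ ha₂ ?_
          rw [Set.mem_ofPred_eq, hs, hu] at ht
          linear_combination ht
        have := hc t
        rw [hct] at this
        rw [Set.mem_ofPred_eq]
        linear_combination this)
    refine hdiv a ha s u hs hu fun x y => ?_
    linear_combination x ^ 3 * h₀ + x ^ 2 * y * h₁ + x * y ^ 2 * h₂ + y ^ 3 * h₃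

end cubic

/-! ### Choosing a real point of the curve in general position. -/

section selection

theorem quad_of_isSymm {N : Matrix (Fin 4) (Fin 4) ℝ} (hN : N.IsSymm) (h : N 3 3 = 0)
    (v : Fin 4 → ℝ) : quad N v =
      N 0 0 * v 0 ^ 2 + N 1 1 * v 1 ^ 2 + N 2 2 * v 2 ^ 2 + 2 * N 0 1 * v 0 * v 1
        + 2 * N 0 2 * v 0 * v 2 + 2 * N 1 2 * v 1 * v 2
        + 2 * v 3 * (N 0 3 * v 0 + N 1 3 * v 1 + N 2 3 * v 2) := by
  simp only [quad, dotProduct, Matrix.mulVec, Fin.sum_univ_four, h, hN.apply 0 1, hN.apply 0 2,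
    hN.apply 0 3, hN.apply 1 2, hN.apply 1 3, hN.apply 2 3]
  ring

/-- Here p is (0:0:0:1) and both forms are linear in w. Eliminating w gives a plane cubic with z³
coefficient as in `hk`; a real point of it lifts to the curve wherever the coefficient of w in A is
nonzero, which is why that linear form joins Λ. A linear factor of the cubic is excluded by
`hq.prime`. -/
theorem exists_real_point_of_normalized {A B : Matrix (Fin 4) (Fin 4) ℝ} (hA : A.IsSymm)
    (hB : B.IsSymm) (hA₃ : A 3 3 = 0) (hB₃ : B 3 3 = 0) (hq : PrimePencil (quad A) (quad B))
    (hind : ∀ α β : ℝ, (∀ i, α * A i 3 + β * B i 3 = 0) → α = 0 ∧ β = 0)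
    (hk : A 2 3 * B 2 2 - B 2 3 * A 2 2 ≠ 0) (Λ : Finset (Fin 4 → ℝ)) (hΛ : ∀ a ∈ Λ, a ≠ 0)
    (hΛ₃ : ∀ a ∈ Λ, a 3 = 0) :
    ∃ v, quad A v = 0 ∧ quad B v = 0 ∧ ∀ a ∈ Λ, a ⬝ᵥ v ≠ 0 := by
  classical
  obtain ⟨l₀, l₁, m₀, m₁, m₂, r₀, r₁, r₂, r₃, hF⟩ : ∃ l₀ l₁ m₀ m₁ m₂ r₀ r₁ r₂ r₃ : ℝ,
      ∀ v : Fin 4 → ℝ, (A 0 3 * v 0 + A 1 3 * v 1 + A 2 3 * v 2) * quad B v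
        - (B 0 3 * v 0 + B 1 3 * v 1 + B 2 3 * v 2) * quad A v =
        (A 2 3 * B 2 2 - B 2 3 * A 2 2) * v 2 ^ 3 + (l₀ * v 0 + l₁ * v 1) * v 2 ^ 2
        + (m₀ * v 0 ^ 2 + m₁ * v 0 * v 1 + m₂ * v 1 ^ 2) * v 2
        + (r₀ * v 0 ^ 3 + r₁ * v 0 ^ 2 * v 1 + r₂ * v 0 * v 1 ^ 2 + r₃ * v 1 ^ 3) := by
    refine ⟨A 0 3 * B 2 2 + 2 * A 2 3 * B 0 2 - (B 0 3 * A 2 2 + 2 * B 2 3 * A 0 2),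
      A 1 3 * B 2 2 + 2 * A 2 3 * B 1 2 - (B 1 3 * A 2 2 + 2 * B 2 3 * A 1 2),
      A 2 3 * B 0 0 + 2 * A 0 3 * B 0 2 - (B 2 3 * A 0 0 + 2 * B 0 3 * A 0 2),
      2 * A 0 3 * B 1 2 + 2 * A 1 3 * B 0 2 + 2 * A 2 3 * B 0 1
        - (2 * B 0 3 * A 1 2 + 2 * B 1 3 * A 0 2 + 2 * B 2 3 * A 0 1),
      A 2 3 * B 1 1 + 2 * A 1 3 * B 1 2 - (B 2 3 * A 1 1 + 2 * B 1 3 * A 1 2),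
      A 0 3 * B 0 0 - B 0 3 * A 0 0,
      A 1 3 * B 0 0 + 2 * A 0 3 * B 0 1 - (B 1 3 * A 0 0 + 2 * B 0 3 * A 0 1),
      A 0 3 * B 1 1 + 2 * A 1 3 * B 0 1 - (B 0 3 * A 1 1 + 2 * B 1 3 * A 0 1),
      A 1 3 * B 1 1 - B 1 3 * A 1 1, fun v => ?_⟩
    rw [quad_of_isSymm hA hA₃, quad_of_isSymm hB hB₃]
    ring
  generalize A 2 3 * B 2 2 - B 2 3 * A 2 2 = k at *
  have hΛ' : ∀ a ∈ insert (fun i => A i 3) Λ, a ≠ 0 := by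
    intro a ha
    rcases Finset.mem_insert.1 ha with rfl | ha
    · intro h0
      exact one_ne_zero (hind 1 0 fun i => by simpa using congrFun h0 i).1
    · exact hΛ a ha
  have hΛ₃' : ∀ a ∈ insert (fun i => A i 3) Λ, a 3 = 0 := by
    intro a ha
    rcases Finset.mem_insert.1 ha with rfl | ha
    · exact hA₃
    · exact hΛ₃ a ha
  obtain ⟨x, y, z, hxyz, hne⟩ := exists_cubic_point hk (insert (fun i => A i 3) Λ) hΛ' hΛ₃'
    (l₀ := l₀) (l₁ := l₁) (m₀ := m₀) (m₁ := m₁) (m₂ := m₂) (r₀ := r₀) (r₁ := r₁) (r₂ := r₂)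
    (r₃ := r₃) (by
      intro a ha s u hs hu hzero
      rcases hq.prime a !![k * s ^ 2 + l₀ * s + m₀, 2 * k * s * u + l₀ * u + l₁ * s + m₁,
          k * s + l₀, 0; 0, k * u ^ 2 + l₁ * u + m₂, k * u + l₁, 0; 0, 0, k, 0; 0, 0, 0, 0]
        (fun i => -(a 2 * B i 3)) (fun i => a 2 * A i 3) (fun v => by
          have hv := hF v
          generalize quad A v = qA at *
          generalize quad B v = qB at *
          simp [quad, Matrix.mulVec, dotProduct, Fin.sum_univ_four, hΛ₃' a ha, hA₃, hB₃]
          rw [hs, hu]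
          linear_combination (-a 2) * hzero (v 0) (v 1) - a 2 * hv) with h | ⟨α, β, h⟩
      · exact hΛ' a ha h
      · have hαβ : ∀ i, α * A i 3 + β * B i 3 = 0 := by
          have e₀ := h ![1, 0, 0, 0]
          have e₁ := h ![0, 1, 0, 0]
          have e₂ := h ![0, 0, 1, 0]
          have e₀' := h ![1, 0, 0, 1]
          have e₁' := h ![0, 1, 0, 1]
          have e₂' := h ![0, 0, 1, 1]
          simp only [quad_of_isSymm hA hA₃, quad_of_isSymm hB hB₃] at e₀ e₁ e₂ e₀' e₁' e₂'
          simp [quad, Matrix.mulVec, dotProduct, Fin.sum_univ_four] at e₀ e₁ e₂ e₀' e₁' e₂'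
          intro i
          fin_cases i <;> simp [hA₃, hB₃]
          · linarith
          · linarith
          · linarith
        obtain ⟨rfl, rfl⟩ := hind α β hαβ
        have := h ![0, 0, 1, 0]
        simp [quad, Matrix.mulVec, dotProduct, Fin.sum_univ_four] at this
        exact hk this)
  have hX := hne _ (Finset.mem_insert_self _ _)
  set g := quad A ![x, y, z, 0] with hg
  set X := A 0 3 * x + A 1 3 * y + A 2 3 * z with hXdef
  have h₁ : quad A ![x, y, z, -g / (2 * X)] = 0 := by
    have hgt : ∀ t, quad A ![x, y, z, t] = g + 2 * t * X := by
      intro t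
      rw [hg, hXdef, quad_of_isSymm hA hA₃, quad_of_isSymm hA hA₃]
      simp only [Matrix.cons_val]
      ring
    rw [hgt]
    field_simp
    ring
  refine ⟨![x, y, z, -g / (2 * X)], h₁, ?_, fun a ha => ?_⟩
  · have := hF ![x, y, z, -g / (2 * X)]
    rw [h₁] at this
    simp only [Matrix.cons_val] at this
    rw [hxyz, ← hXdef, mul_zero, sub_zero] at this
    exact (mul_eq_zero.1 this).resolve_left hX
  · have := hne a (Finset.mem_insert_of_mem ha)
    simpa [dotProduct, Fin.sum_univ_four, hΛ₃ a ha] using this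

theorem exists_dotProduct_eq_zero_and_ne_zero {a b : Fin 4 → ℝ}
    (h : ∀ α β : ℝ, α • a + β • b = 0 → α = 0 ∧ β = 0) : ∃ u, a ⬝ᵥ u = 0 ∧ b ⬝ᵥ u = 1 := by
  set u := (a ⬝ᵥ a) • b - (a ⬝ᵥ b) • a with hu
  have hau : a ⬝ᵥ u = 0 := by
    simp [hu, dotProduct_sub, dotProduct_smul]
    ring
  have hbu : b ⬝ᵥ u ≠ 0 := by
    intro hb
    have huu : u ⬝ᵥ u = 0 := by
      nth_rw 1 [hu]
      simp [sub_dotProduct, smul_dotProduct, hau, hb]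
    have hu0 : u = 0 := dotProduct_self_eq_zero.1 huu
    have := (h (-(a ⬝ᵥ b)) (a ⬝ᵥ a) (by rw [← hu0, hu]; module)).2
    have ha : a = 0 := dotProduct_self_eq_zero.1 this
    exact one_ne_zero (h 1 0 (by simp [ha])).1
  exact ⟨(b ⬝ᵥ u)⁻¹ • u, by simp [hau], by simp [hbu]⟩

theorem quad_add_smul {M : Matrix (Fin 4) (Fin 4) ℝ} (hM : M.IsSymm) (u v : Fin 4 → ℝ) (t : ℝ) :
    quad M (u + t • v) = quad M u + 2 * t * (M *ᵥ v ⬝ᵥ u) + t ^ 2 * quad M v := by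
  have h : v ⬝ᵥ M *ᵥ u = M *ᵥ v ⬝ᵥ u := by
    rw [Matrix.dotProduct_mulVec, ← Matrix.mulVec_transpose, hM.eq]
  have h' : u ⬝ᵥ M *ᵥ v = M *ᵥ v ⬝ᵥ u := dotProduct_comm _ _
  simp only [quad, Matrix.mulVec_add, Matrix.mulVec_smul, add_dotProduct, dotProduct_add,
    smul_dotProduct, dotProduct_smul, smul_eq_mul, h, h']
  ring

/-- The cone over the projection of the curve from its smooth point `p` is a proper cubic. -/
theorem exists_cubic_ne_zero {A B : Matrix (Fin 4) (Fin 4) ℝ} (hA : A.IsSymm)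
    (hq : PrimePencil (quad A) (quad B)) {p : Fin 4 → ℝ} (hAp : quad A p = 0)
    (hind : ∀ α β : ℝ, α • A *ᵥ p + β • B *ᵥ p = 0 → α = 0 ∧ β = 0) :
    ∃ v, (A *ᵥ p ⬝ᵥ v) * quad B v - (B *ᵥ p ⬝ᵥ v) * quad A v ≠ 0 := by
  by_contra! hzero
  obtain ⟨u, hau, hbu⟩ := exists_dotProduct_eq_zero_and_ne_zero hind
  obtain ⟨w, -, haw⟩ := exists_dotProduct_eq_zero_and_ne_zero
    (fun α β h => (hind β α (by rw [add_comm]; exact h)).symm)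
  -- Moving v along u stays in the tangent plane of A at p while `B *ᵥ p` grows at unit rate. The
  -- coefficients of the resulting polynomial in s force A to vanish on that plane.
  have hker : ∀ v, A *ᵥ p ⬝ᵥ v = 0 → quad A v = 0 := by
    intro v hv
    have hs : ∀ s : ℝ, (B *ᵥ p ⬝ᵥ v + s) *
        (quad A v + 2 * s * (A *ᵥ u ⬝ᵥ v) + s ^ 2 * quad A u) = 0 := by
      intro s
      have := hzero (v + s • u)
      rw [quad_add_smul hA, dotProduct_add, dotProduct_add, dotProduct_smul, dotProduct_smul, hv,
        hau, hbu] at this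
      simp only [smul_eq_mul] at this
      linear_combination -this
    obtain ⟨h₀, h₁, h₂, h₃⟩ := cubic_coeff_eq_zero (c₀ := (B *ᵥ p ⬝ᵥ v) * quad A v)
      (c₁ := quad A v + 2 * (B *ᵥ p ⬝ᵥ v) * (A *ᵥ u ⬝ᵥ v))
      (c₂ := 2 * (A *ᵥ u ⬝ᵥ v) + (B *ᵥ p ⬝ᵥ v) * quad A u) (c₃ := quad A u) (by
        convert Set.infinite_univ (α := ℝ)
        refine Set.eq_univ_of_forall fun t => ?_
        rw [Set.mem_ofPred_eq]
        linear_combination hs t)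
    rw [h₃] at h₂
    have h₄ : A *ᵥ u ⬝ᵥ v = 0 := by linarith
    rw [h₄] at h₁
    linarith
  -- Projecting v along w into the tangent plane exhibits the cofactor of its equation in A.
  have hprod : ∀ v, (A *ᵥ p ⬝ᵥ v) * (((2 : ℝ) • A *ᵥ w - (quad A w) • A *ᵥ p) ⬝ᵥ v) =
      1 * quad A v + 0 * quad B v := by
    intro v
    have := hker (v + (-(A *ᵥ p ⬝ᵥ v)) • w) (by simp [dotProduct_add, haw])
    rw [quad_add_smul hA] at this
    simp only [sub_dotProduct, smul_dotProduct, smul_eq_mul]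
    linear_combination -this
  have hwp : A *ᵥ w ⬝ᵥ p = 1 := by
    rw [← haw, dotProduct_comm, Matrix.dotProduct_mulVec, ← Matrix.mulVec_transpose, hA.eq]
  rcases hq.irred 1 0 _ _ hprod with h | h
  · rw [h] at haw
    simp at haw
  · have h1 : ((2 : ℝ) • A *ᵥ w - (quad A w) • A *ᵥ p) ⬝ᵥ p = 0 := by rw [h]; simp
    have h2 : A *ᵥ p ⬝ᵥ p = 0 := by rw [dotProduct_comm]; exact hAp
    simp [sub_dotProduct, smul_dotProduct, hwp, h2] at h1

/-- Real points of the curve outside finitely many planes through a smooth real point. -/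
theorem exists_real_point {A B : Matrix (Fin 4) (Fin 4) ℝ} (hA : A.IsSymm) (hB : B.IsSymm)
    (hq : PrimePencil (quad A) (quad B)) {p : Fin 4 → ℝ} (hAp : quad A p = 0)
    (hBp : quad B p = 0) (hind : ∀ α β : ℝ, α • A *ᵥ p + β • B *ᵥ p = 0 → α = 0 ∧ β = 0)
    (Λ : Finset (Fin 4 → ℝ)) (hΛ : ∀ a ∈ Λ, a ≠ 0) (hΛp : ∀ a ∈ Λ, a ⬝ᵥ p = 0) :
    ∃ v, quad A v = 0 ∧ quad B v = 0 ∧ ∀ a ∈ Λ, a ⬝ᵥ v ≠ 0 := by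
  classical
  -- With o and p as third and fourth basis vectors, `ho` says that the projected cubic has a
  -- nonzero z³ coefficient.
  obtain ⟨o, ho⟩ := exists_cubic_ne_zero hA hq hAp hind
  have hp0 : p ≠ 0 := by
    rintro rfl
    exact one_ne_zero (hind 1 0 (by simp)).1
  have hop : LinearIndependent ℝ ![o, p] := by
    rw [LinearIndependent.pair_iff]
    intro s t hst
    have hs : s = 0 := by
      by_contra hs
      have : o = (-(t / s)) • p := by
        have : s • o = (-t) • p := by rw [neg_smul]; exact eq_neg_of_add_eq_zero_left hst
        rw [← inv_smul_smul₀ hs o, this, smul_smul]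
        congr 1
        ring
      apply ho
      have hz : ∀ M : Matrix (Fin 4) (Fin 4) ℝ, quad M p = 0 → quad M ((-(t / s)) • p) = 0 := by
        intro M hM
        simp only [quad] at hM
        simp [quad, Matrix.mulVec_neg, Matrix.mulVec_smul, hM]
      rw [this, hz A hAp, hz B hBp]
      simp
    subst hs
    simpa [hp0] using hst
  obtain ⟨w, hw⟩ := exists_linearIndependent_cons_of_lt_finrank hop (by simp)
  obtain ⟨v, hv⟩ := exists_linearIndependent_cons_of_lt_finrank hw (by simp)
  set U : Matrix (Fin 4) (Fin 4) ℝ := (Matrix.of (Fin.cons v (Fin.cons w ![o, p])))ᵀ with hUdef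
  have hU : IsUnit U := Matrix.linearIndependent_cols_iff_isUnit.1 hv
  have hU₂ : U.col 2 = o := rfl
  have hU₃ : U.col 3 = p := rfl
  have hent : ∀ (M : Matrix (Fin 4) (Fin 4) ℝ) i j,
      (Uᵀ * M * U) i j = U.col i ⬝ᵥ M *ᵥ U.col j := by
    intro M i j
    rw [Matrix.mul_assoc, Matrix.mul_apply']
    rfl
  have hcol : ∀ M : Matrix (Fin 4) (Fin 4) ℝ, ∀ i,
      (Uᵀ * M * U) i 3 = ((M *ᵥ p) ᵥ* U) i := by
    intro M i
    rw [hent, hU₃, dotProduct_comm]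
    rfl
  have hsymm : ∀ M : Matrix (Fin 4) (Fin 4) ℝ, M.IsSymm → (Uᵀ * M * U).IsSymm := by
    intro M hM
    simp [Matrix.IsSymm, Matrix.transpose_mul, hM.eq, Matrix.mul_assoc]
  have hinj : ∀ a : Fin 4 → ℝ, a ᵥ* U = 0 → a = 0 := by
    intro a ha
    have h1 : (a ᵥ* U) ᵥ* U⁻¹ = a := by
      rw [Matrix.vecMul_vecMul, Matrix.mul_nonsing_inv _ ((Matrix.isUnit_iff_isUnit_det _).1 hU),
        Matrix.vecMul_one]
    rw [← h1, ha, Matrix.zero_vecMul]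
  obtain ⟨ξ, h₁, h₂, h₃⟩ := exists_real_point_of_normalized (hsymm A hA) (hsymm B hB)
    (by rw [hent, hU₃]; exact hAp) (by rw [hent, hU₃]; exact hBp)
    (by simpa only [quad_mulVec] using hq.comp hU)
    (by
      intro α β h
      refine hind α β (hinj _ ?_)
      ext i
      rw [Matrix.add_vecMul, Matrix.smul_vecMul, Matrix.smul_vecMul]
      simpa [hcol] using h i)
    (by
      rw [hent, hent, hent, hent, hU₂, hU₃]
      simpa [quad, dotProduct_comm o] using ho)
    (Λ.image fun a => a ᵥ* U)
    (by
      intro a ha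
      obtain ⟨b, hb, rfl⟩ := Finset.mem_image.1 ha
      exact fun h => hΛ b hb (hinj b h))
    (by
      intro a ha
      obtain ⟨b, hb, rfl⟩ := Finset.mem_image.1 ha
      exact hΛp b hb)
  refine ⟨U *ᵥ ξ, by rw [quad_mulVec, h₁], by rw [quad_mulVec, h₂], fun a ha => ?_⟩
  rw [Matrix.dotProduct_mulVec]
  exact h₃ _ (Finset.mem_image_of_mem _ ha)

end selection

/-! ### Bringing the pencil and the centres to normal form. -/

namespace QuarticCoeff

variable {k : Type*} [Field k] (q : QuarticCoeff k)

/-- The symmetric matrix of `form₁`. -/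
def matrix₁ : Matrix (Fin 4) (Fin 4) k :=
  !![q.d, q.e / 2, q.g / 2, 1 / 2; q.e / 2, q.f, q.h / 2, 0; q.g / 2, q.h / 2, 0, 0; 1 / 2, 0, 0, 0]

/-- The symmetric matrix of `form₂`. -/
def matrix₂ : Matrix (Fin 4) (Fin 4) k :=
  !![q.a, q.b / 2, 0, 0; q.b / 2, q.c, 0, 0; 0, 0, 0, 1 / 2; 0, 0, 1 / 2, 0]

theorem quad_matrix₁ [CharZero k] (v : Fin 4 → k) : quad q.matrix₁ v = q.form₁ v := by
  simp [quad, matrix₁, form₁, dotProduct, Matrix.mulVec, Fin.sum_univ_four]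
  field_simp
  ring

theorem quad_matrix₂ [CharZero k] (v : Fin 4 → k) : quad q.matrix₂ v = q.form₂ v := by
  simp [quad, matrix₂, form₂, dotProduct, Matrix.mulVec, Fin.sum_univ_four]
  field_simp
  ring

theorem form₁_smul (r : k) (v : Fin 4 → k) : q.form₁ (r • v) = r ^ 2 * q.form₁ v := by
  simp only [form₁, Pi.smul_apply, smul_eq_mul]
  ring

theorem form₂_smul (r : k) (v : Fin 4 → k) : q.form₂ (r • v) = r ^ 2 * q.form₂ v := by
  simp only [form₂, Pi.smul_apply, smul_eq_mul]
  ring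

end QuarticCoeff

theorem exists_ne_zero_dotProduct_eq_zero (a b c : Fin 4 → ℝ) :
    ∃ u : Fin 4 → ℝ, u ≠ 0 ∧ a ⬝ᵥ u = 0 ∧ b ⬝ᵥ u = 0 ∧ c ⬝ᵥ u = 0 := by
  obtain ⟨u, hu, h⟩ := Matrix.exists_mulVec_eq_zero_iff.2
    (Matrix.det_eq_zero_of_row_eq_zero (A := Matrix.of ![a, b, c, 0]) 3 (fun j => rfl))
  exact ⟨u, hu, congrFun h 0, congrFun h 1, congrFun h 2⟩

theorem dotProduct_mulVec_comm {M : Matrix (Fin 4) (Fin 4) ℝ} (hM : M.IsSymm)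
    (u v : Fin 4 → ℝ) : u ⬝ᵥ M *ᵥ v = v ⬝ᵥ M *ᵥ u := by
  rw [Matrix.dotProduct_mulVec, ← Matrix.mulVec_transpose, hM.eq, dotProduct_comm]

theorem quad_smul_matrix (A B : Matrix (Fin 4) (Fin 4) ℝ) (s t : ℝ) (v : Fin 4 → ℝ) :
    quad (s • A + t • B) v = s * quad A v + t * quad B v := by
  simp [quad, Matrix.add_mulVec, Matrix.smul_mulVec, dotProduct_add, dotProduct_smul]

/-- Coordinates in which a pencil of quadrics has the normal form `QuarticCoeff`, given a smooth
point `p` and a second point `o` of the curve that is not in the tangent direction at `p`. -/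
theorem exists_normal_form {A B : Matrix (Fin 4) (Fin 4) ℝ} (hA : A.IsSymm) (hB : B.IsSymm)
    {p o : Fin 4 → ℝ} (hAp : quad A p = 0) (hBp : quad B p = 0) (hAo : quad A o = 0)
    (hBo : quad B o = 0) (hX : A *ᵥ p ≠ 0) (hXo : A *ᵥ p ⬝ᵥ o = 0)
    (hZo : (2 : ℝ) • B *ᵥ p ⬝ᵥ o = 1) :
    ∃ (U : Matrix (Fin 4) (Fin 4) ℝ) (q : QuarticCoeff ℝ), IsUnit U ∧ U.col 2 = o ∧ U.col 3 = p ∧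
      Uᵀ * A * U = q.matrix₁ ∧ Uᵀ * B * U = q.matrix₂ ∧
      (∀ v, (2 : ℝ) • A *ᵥ p ⬝ᵥ (U *ᵥ v) = v 0) ∧ ∀ v, (2 : ℝ) • B *ᵥ p ⬝ᵥ (U *ᵥ v) = v 2 := by
  -- X, Z and Y become the coordinates x, z and w: the tangent planes of A and B at p, and of B at
  -- o. Basis vectors x and y taken in Z = Y = 0 free the second form of xw, yw, xz and yz terms.
  set X := (2 : ℝ) • A *ᵥ p with hXdef
  set Z := (2 : ℝ) • B *ᵥ p with hZdef
  set Y := (2 : ℝ) • B *ᵥ o with hYdef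
  have hX0 : X ≠ 0 := smul_ne_zero two_ne_zero hX
  have hXp : X ⬝ᵥ p = 0 := by
    rw [hXdef, smul_dotProduct, dotProduct_comm]
    simp only [quad] at hAp
    simp [hAp]
  have hXo' : X ⬝ᵥ o = 0 := by
    rw [hXdef, smul_dotProduct, hXo, smul_zero]
  have hZp : Z ⬝ᵥ p = 0 := by
    rw [hZdef, smul_dotProduct, dotProduct_comm]
    simp only [quad] at hBp
    simp [hBp]
  have hYp : Y ⬝ᵥ p = 1 := by
    rw [← hZo, hYdef, hZdef, smul_dotProduct, smul_dotProduct, dotProduct_comm,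
      dotProduct_mulVec_comm hB, dotProduct_comm]
  have hYo : Y ⬝ᵥ o = 0 := by
    rw [hYdef, smul_dotProduct, dotProduct_comm]
    simp only [quad] at hBo
    simp [hBo]
  obtain ⟨w, hw⟩ : ∃ w, X ⬝ᵥ w = 1 := by
    have : X ⬝ᵥ X ≠ 0 := fun h => hX0 (dotProduct_self_eq_zero.1 h)
    exact ⟨(X ⬝ᵥ X)⁻¹ • X, by simp [this]⟩
  obtain ⟨x, hXx, hZx, hYx⟩ : ∃ x, X ⬝ᵥ x = 1 ∧ Z ⬝ᵥ x = 0 ∧ Y ⬝ᵥ x = 0 := by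
    refine ⟨w - (Z ⬝ᵥ w) • o - (Y ⬝ᵥ w) • p, ?_, ?_, ?_⟩ <;>
      simp [dotProduct_sub, dotProduct_smul, hw, hXp, hXo', hZo, hZp, hYp, hYo]
  obtain ⟨y, hy0, hXy, hZy, hYy⟩ := exists_ne_zero_dotProduct_eq_zero X Z Y
  set U : Matrix (Fin 4) (Fin 4) ℝ := (Matrix.of ![x, y, o, p])ᵀ with hUdef
  have hU₀ : U.col 0 = x := rfl
  have hU₁ : U.col 1 = y := rfl
  have hU₂ : U.col 2 = o := rfl
  have hU₃ : U.col 3 = p := rfl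
  have hUv : ∀ v, U *ᵥ v = v 0 • x + v 1 • y + v 2 • o + v 3 • p := by
    intro v
    ext i
    simp [Matrix.mulVec, dotProduct, Fin.sum_univ_four, hUdef]
    ring
  have hXU : ∀ v, X ⬝ᵥ (U *ᵥ v) = v 0 := by
    intro v
    simp [hUv, dotProduct_add, dotProduct_smul, hXx, hXy, hXo', hXp]
  have hZU : ∀ v, Z ⬝ᵥ (U *ᵥ v) = v 2 := by
    intro v
    simp [hUv, dotProduct_add, dotProduct_smul, hZx, hZy, hZo, hZp]
  have hYU : ∀ v, Y ⬝ᵥ (U *ᵥ v) = v 3 := by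
    intro v
    simp [hUv, dotProduct_add, dotProduct_smul, hYx, hYy, hYo, hYp]
  have hU : IsUnit U := by
    rw [Matrix.isUnit_iff_isUnit_det, isUnit_iff_ne_zero]
    intro hdet
    obtain ⟨v, hv, hUv0⟩ := Matrix.exists_mulVec_eq_zero_iff.2 hdet
    have h₀ : v 0 = 0 := by rw [← hXU v, hUv0, dotProduct_zero]
    have h₂ : v 2 = 0 := by rw [← hZU v, hUv0, dotProduct_zero]
    have h₃ : v 3 = 0 := by rw [← hYU v, hUv0, dotProduct_zero]
    have h₁ : v 1 = 0 := by
      rw [hUv, h₀, h₂, h₃] at hUv0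
      simpa [hy0] using hUv0
    apply hv
    ext i
    fin_cases i <;> simp [h₀, h₁, h₂, h₃]
  have hent : ∀ (M : Matrix (Fin 4) (Fin 4) ℝ) i j,
      (Uᵀ * M * U) i j = U.col i ⬝ᵥ M *ᵥ U.col j := by
    intro M i j
    rw [Matrix.mul_assoc, Matrix.mul_apply']
    rfl
  have half : ∀ (M : Matrix (Fin 4) (Fin 4) ℝ) u v (r : ℝ), (2 : ℝ) • M *ᵥ u ⬝ᵥ v = r →
      v ⬝ᵥ M *ᵥ u = r / 2 := by
    intro M u v r h
    rw [smul_dotProduct, dotProduct_comm, smul_eq_mul] at h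
    linarith
  refine ⟨U, ⟨x ⬝ᵥ B *ᵥ x, 2 * (x ⬝ᵥ B *ᵥ y), y ⬝ᵥ B *ᵥ y, x ⬝ᵥ A *ᵥ x, 2 * (x ⬝ᵥ A *ᵥ y),
    y ⬝ᵥ A *ᵥ y, 2 * (x ⬝ᵥ A *ᵥ o), 2 * (y ⬝ᵥ A *ᵥ o)⟩, hU, hU₂, hU₃, ?_, ?_, hXU, hZU⟩
  · have e₀ := half A p x _ hXx
    have e₁ := half A p y _ hXy
    have e₂ := half A p o _ hXo'
    have c₀ := dotProduct_mulVec_comm hA p x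
    have c₁ := dotProduct_mulVec_comm hA p y
    have c₂ := dotProduct_mulVec_comm hA p o
    have c₃ := dotProduct_mulVec_comm hA y x
    have c₄ := dotProduct_mulVec_comm hA o x
    have c₅ := dotProduct_mulVec_comm hA o y
    simp only [quad] at hAp hAo
    ext i j
    rw [hent]
    fin_cases i <;> fin_cases j <;>
      simp [QuarticCoeff.matrix₁, hU₀, hU₁, hU₂, hU₃, e₀, e₁, e₂, c₀, c₁, c₂, c₃, c₄, c₅, hAp, hAo]
  · have e₀ := half B p x _ hZx
    have e₁ := half B p y _ hZy
    have e₂ := half B p o _ hZo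
    have e₃ := half B o x _ hYx
    have e₄ := half B o y _ hYy
    have c₀ := dotProduct_mulVec_comm hB p x
    have c₁ := dotProduct_mulVec_comm hB p y
    have c₂ := dotProduct_mulVec_comm hB p o
    have c₃ := dotProduct_mulVec_comm hB y x
    have c₄ := dotProduct_mulVec_comm hB o x
    have c₅ := dotProduct_mulVec_comm hB o y
    simp only [quad] at hBp hBo
    ext i j
    rw [hent]
    fin_cases i <;> fin_cases j <;>
      simp [QuarticCoeff.matrix₂, hU₀, hU₁, hU₂, hU₃, e₀, e₁, e₂, e₃, e₄, c₀, c₁, c₂, c₃, c₄, c₅,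
        hBp, hBo]

/-- Simultaneous normal form of the pencil and of the camera centres. -/
theorem exists_adapted_coordinates {n : ℕ} {M₁ M₂ : Matrix (Fin 4) (Fin 4) ℝ} (h₁ : M₁.IsSymm)
    (h₂ : M₂.IsSymm) (hq : PrimePencil (quad M₁) (quad M₂)) (c : Fin n → Fin 4 → ℝ) (i₀ : Fin n)
    (hc₁ : ∀ i, quad M₁ (c i) = 0) (hc₂ : ∀ i, quad M₂ (c i) = 0)
    (hne : ∀ i j, i ≠ j → ∀ t : ℝ, c i ≠ t • c j)
    (hind : ∀ α β : ℝ, α • M₁ *ᵥ c i₀ + β • M₂ *ᵥ c i₀ = 0 → α = 0 ∧ β = 0) :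
    ∃ (U : Matrix (Fin 4) (Fin 4) ℝ) (q : QuarticCoeff ℝ) (s t : ℝ) (ξ : Fin n → Fin 4 → ℝ)
      (r : Fin n → ℝ), IsUnit U ∧ PrimePencil q.form₁ q.form₂ ∧
      Uᵀ * (s • M₁ + t • M₂) * U = q.matrix₁ ∧ Uᵀ * (s⁻¹ • M₂) * U = q.matrix₂ ∧
      U.col 3 = c i₀ ∧
      (∀ i, i ≠ i₀ → q.OnCurve (ξ i) ∧ r i ≠ 0 ∧ c i = r i • U *ᵥ ξ i) ∧
      ∀ i j, i ≠ i₀ → j ≠ i₀ → i ≠ j → ξ i 1 ≠ ξ j 1 := by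
  classical
  set p := c i₀ with hp
  set X := M₁ *ᵥ p with hX
  set Z := M₂ *ᵥ p with hZ
  have hX0 : X ≠ 0 := fun h => one_ne_zero (hind 1 0 (by simp [h])).1
  have hZ0 : Z ≠ 0 := fun h => one_ne_zero (hind 0 1 (by simp [h])).2
  have hXp : X ⬝ᵥ p = 0 := by rw [dotProduct_comm]; exact hc₁ i₀
  have hZp : Z ⬝ᵥ p = 0 := by rw [dotProduct_comm]; exact hc₂ i₀
  let ν : Fin n → Fin 4 → ℝ := fun i =>
    if X ⬝ᵥ c i = 0 ∧ Z ⬝ᵥ c i = 0 then X else (X ⬝ᵥ c i) • Z - (Z ⬝ᵥ c i) • X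
  -- Planes through p and two centres. If o avoids them, distinct centres other than p have distinct
  -- y-coordinates once x = 1.
  choose μ hμ0 hμp hμi hμj using fun ij : Fin n × Fin n =>
    exists_ne_zero_dotProduct_eq_zero p (c ij.1) (c ij.2)
  obtain ⟨o, ho₁, ho₂, hΛ⟩ := exists_real_point h₁ h₂ hq (hc₁ i₀) (hc₂ i₀) hind
    ({X, Z} ∪ Finset.univ.image ν ∪ Finset.univ.image μ)
    (by
      intro a ha
      simp only [Finset.mem_union, Finset.mem_insert, Finset.mem_singleton, Finset.mem_image,
        Finset.mem_univ, true_and] at ha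
      rcases ha with ((rfl | rfl) | ⟨i, rfl⟩) | ⟨ij, rfl⟩
      · exact hX0
      · exact hZ0
      · simp only [ν]
        split_ifs with h
        · exact hX0
        · intro h0
          have := hind (-(Z ⬝ᵥ c i)) (X ⬝ᵥ c i) (by rw [← h0]; module)
          exact h ⟨this.2, neg_eq_zero.1 this.1⟩
      · exact hμ0 ij)
    (by
      intro a ha
      simp only [Finset.mem_union, Finset.mem_insert, Finset.mem_singleton, Finset.mem_image,
        Finset.mem_univ, true_and] at ha
      rcases ha with ((rfl | rfl) | ⟨i, rfl⟩) | ⟨ij, rfl⟩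
      · exact hXp
      · exact hZp
      · simp only [ν]
        split_ifs with h
        · exact hXp
        · rw [sub_dotProduct, smul_dotProduct, smul_dotProduct, hXp, hZp]
          simp
      · rw [dotProduct_comm]
        exact hμp ij)
  have hZo : Z ⬝ᵥ o ≠ 0 := hΛ Z (by simp)
  have hνo : ∀ i, ν i ⬝ᵥ o ≠ 0 := fun i => hΛ _ (by simp)
  have hμo : ∀ ij, μ ij ⬝ᵥ o ≠ 0 := fun ij => hΛ _ (by simp)
  -- These scalars put o in the tangent plane at p of the new first quadric and, through s⁻¹, make
  -- the new second form have wz coefficient 1.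
  set s := 2 * (Z ⬝ᵥ o) with hs
  have hs0 : s ≠ 0 := mul_ne_zero two_ne_zero hZo
  set t := -(2 * (X ⬝ᵥ o)) with ht
  have hAp : (s • M₁ + t • M₂) *ᵥ p = s • X + t • Z := by
    rw [Matrix.add_mulVec, Matrix.smul_mulVec, Matrix.smul_mulVec]
  have hBp : (s⁻¹ • M₂) *ᵥ p = s⁻¹ • Z := by
    rw [Matrix.smul_mulVec]
  have hBq : ∀ v, quad (s⁻¹ • M₂) v = s⁻¹ * quad M₂ v := by
    intro v
    simp [quad, Matrix.smul_mulVec]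
  obtain ⟨U, q, hU, hU₂, hU₃, hq₁, hq₂, hx, hz⟩ := exists_normal_form
    (A := s • M₁ + t • M₂) (B := s⁻¹ • M₂) (p := p) (o := o)
    ((h₁.smul s).add (h₂.smul t)) (h₂.smul _)
    (by rw [quad_smul_matrix, hc₁ i₀, hc₂ i₀]; simp) (by rw [hBq, hc₂ i₀]; simp)
    (by rw [quad_smul_matrix, ho₁, ho₂]; simp) (by rw [hBq, ho₂]; simp)
    (by
      rw [hAp]
      exact fun h => hs0 (hind s t h).1)
    (by
      rw [hAp]
      simp [add_dotProduct, hs, ht]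
      ring)
    (by
      rw [hBp]
      simp [hs]
      field_simp)
  have hform₁ : ∀ v, q.form₁ v = s * quad M₁ (U *ᵥ v) + t * quad M₂ (U *ᵥ v) := by
    intro v
    rw [← q.quad_matrix₁, ← hq₁, ← quad_mulVec, quad_smul_matrix]
  have hform₂ : ∀ v, q.form₂ v = s⁻¹ * quad M₂ (U *ᵥ v) := by
    intro v
    rw [← q.quad_matrix₂, ← hq₂, ← quad_mulVec, hBq]
  have hpencil : PrimePencil q.form₁ q.form₂ := by
    have := (hq.change hs0 t).comp hU
    rwa [show q.form₁ = _ from funext hform₁, show q.form₂ = _ from funext hform₂]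
  choose ζ hζ using fun i => (Matrix.mulVec_surjective_iff_isUnit.2 hU) (c i)
  have hζ₁ : ∀ i, q.form₁ (ζ i) = 0 := fun i => by rw [hform₁, hζ, hc₁, hc₂]; simp
  have hζ₂ : ∀ i, q.form₂ (ζ i) = 0 := fun i => by rw [hform₂, hζ, hc₂]; simp
  have hU3 : ∀ v : Fin 4 → ℝ, v 0 = 0 → v 1 = 0 → v 2 = 0 → U *ᵥ v = v 3 • p := by
    intro v h0 h1 h2
    ext i
    have : U i 3 = p i := congrFun hU₃ i
    simp [Matrix.mulVec, dotProduct, Fin.sum_univ_four, h0, h1, h2, this, mul_comm]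
  have hζ0 : ∀ i, i ≠ i₀ → ζ i 0 ≠ 0 := by
    intro i hi h0
    have hx' := hx (ζ i)
    have hz' := hz (ζ i)
    rw [hζ, hAp, h0] at hx'
    rw [hζ, hBp] at hz'
    simp [add_dotProduct] at hx' hz'
    have hν := hνo i
    simp only [ν] at hν
    split_ifs at hν with h
    -- A centre on the tangent line at p would equal p, because `c` or `f` is nonzero.
    · rw [h.2, mul_zero, mul_zero] at hz'
      have hf₁ := hζ₁ i
      have hf₂ := hζ₂ i
      simp [QuarticCoeff.form₁, QuarticCoeff.form₂, h0, ← hz'] at hf₁ hf₂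
      have h1 : ζ i 1 = 0 := by
        rcases QuarticCoeff.c_ne_zero_or_f_ne_zero hpencil with h | h
        · exact hf₂.resolve_left h
        · exact hf₁.resolve_left h
      exact hne i i₀ hi _ ((hζ i).symm.trans (hU3 _ h0 h1 hz'.symm))
    · apply hν
      simp only [sub_dotProduct, smul_dotProduct, smul_eq_mul]
      rw [hs, ht] at hx'
      linear_combination hx' / 4
  have hcurve : ∀ i, i ≠ i₀ → q.OnCurve ((ζ i 0)⁻¹ • ζ i) := fun i hi =>
    ⟨by simp [hζ0 i hi], by rw [q.form₁_smul, hζ₁, mul_zero], by rw [q.form₂_smul, hζ₂, mul_zero]⟩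
  have hci : ∀ i, i ≠ i₀ → c i = ζ i 0 • U *ᵥ ((ζ i 0)⁻¹ • ζ i) := by
    intro i hi
    rw [Matrix.mulVec_smul, smul_inv_smul₀ (hζ0 i hi), hζ]
  refine ⟨U, q, s, t, fun i => (ζ i 0)⁻¹ • ζ i, fun i => ζ i 0, hU, hpencil, hq₁, hq₂, hU₃,
    fun i hi => ⟨hcurve i hi, hζ0 i hi, hci i hi⟩, fun i j hi hj hij h1 => ?_⟩
  dsimp only at h1
  generalize hξi : (ζ i 0)⁻¹ • ζ i = ξ at h1
  generalize hξj : (ζ j 0)⁻¹ • ζ j = ξ' at h1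
  have hon := hcurve i hi
  have hon' := hcurve j hj
  have e := hci i hi
  have e' := hci j hj
  rw [hξi] at hon e
  rw [hξj] at hon' e'
  have hdiff : U *ᵥ (ξ - ξ') = (ξ 2 - ξ' 2) • o + (ξ 3 - ξ' 3) • p := by
    ext l
    have h2 : U l 2 = o l := congrFun hU₂ l
    have h3 : U l 3 = p l := congrFun hU₃ l
    simp [Matrix.mulVec, dotProduct, Fin.sum_univ_four, hon.affine, hon'.affine, h1, h2, h3]
    ring
  have hμU : ∀ (l : Fin n) (ξ : Fin 4 → ℝ), μ (i, j) ⬝ᵥ c l = 0 → c l = ζ l 0 • U *ᵥ ξ →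
      l ≠ i₀ → μ (i, j) ⬝ᵥ (U *ᵥ ξ) = 0 := by
    intro l ξ h0 h hl
    rw [h, dotProduct_smul, smul_eq_mul] at h0
    exact (mul_eq_zero.1 h0).resolve_left (hζ0 l hl)
  have hz2 : ξ 2 = ξ' 2 := by
    have h0 : μ (i, j) ⬝ᵥ (U *ᵥ (ξ - ξ')) = 0 := by
      rw [Matrix.mulVec_sub, dotProduct_sub,
        hμU i ξ (by rw [dotProduct_comm]; exact hμi (i, j)) e hi,
        hμU j ξ' (by rw [dotProduct_comm]; exact hμj (i, j)) e' hj, sub_zero]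
    rw [hdiff, dotProduct_add, dotProduct_smul, dotProduct_smul, dotProduct_comm _ p,
      hμp (i, j), smul_zero, add_zero, smul_eq_mul] at h0
    exact sub_eq_zero.1 ((mul_eq_zero.1 h0).resolve_right (hμo (i, j)))
  have hz3 : ξ 3 = ξ' 3 := by
    have d := hon.d_eq
    have d' := hon'.d_eq
    simp only [QuarticCoeff.sigma, h1, hz2] at d d'
    linarith
  have heq : ξ = ξ' := by
    ext l
    fin_cases l
    · exact hon.affine.trans hon'.affine.symm
    · exact h1
    · exact hz2
    · exact hz3
  refine hne i j hij (ζ i 0 * (ζ j 0)⁻¹) ?_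
  rw [e, e', heq, smul_smul, mul_assoc, inv_mul_cancel₀ (hζ0 j hj), mul_one]


/-! ### Camera centres, fundamental matrices and image points. -/

namespace Camera

theorem vecMul_eq_zero (P : Camera) {r : Fin 3 → ℝ} (h : r ᵥ* P.mat = 0) : r = 0 := by
  have hs : Function.Surjective P.mat.mulVecLin := by
    rw [← LinearMap.range_eq_top]
    apply Submodule.eq_top_of_finrank_eq
    have h := P.full_rank
    rw [Matrix.rank] at h
    rw [h]
    simp
  obtain ⟨v, hv⟩ := hs r
  rw [Matrix.mulVecLin_apply] at hv
  have : r ⬝ᵥ r = 0 := by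
    nth_rw 2 [← hv]
    rw [Matrix.dotProduct_mulVec, h, zero_dotProduct]
  exact dotProduct_self_eq_zero.1 this

/-- The camera given by a matrix with independent rows. -/
def ofVecMul (M : Matrix (Fin 3) (Fin 4) ℝ) (h : ∀ r, r ᵥ* M = 0 → r = 0) : Camera where
  mat := M
  full_rank := by
    have hM : LinearIndependent ℝ M.row := by
      rw [← Matrix.vecMul_injective_iff]
      intro a b hab
      rw [← sub_eq_zero]
      apply h
      rw [Matrix.sub_vecMul]
      exact sub_eq_zero.2 hab
    simpa using hM.rank_matrix

theorem matC_mulVec (P : Camera) (v : Fin 4 → ℝ) :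
    P.matC *ᵥ (algebraMap ℝ ℂ ∘ v) = algebraMap ℝ ℂ ∘ (P.mat *ᵥ v) := by
  ext i
  exact (RingHom.map_mulVec (algebraMap ℝ ℂ) P.mat v i).symm

theorem exists_real_kernel (P : Camera) : ∃ c : Fin 4 → ℝ, c ≠ 0 ∧ P.mat *ᵥ c = 0 := by
  obtain ⟨c, hc, h₀, h₁, h₂⟩ := exists_ne_zero_dotProduct_eq_zero (P.mat 0) (P.mat 1) (P.mat 2)
  refine ⟨c, hc, ?_⟩
  ext i
  fin_cases i
  · exact h₀
  · exact h₁
  · exact h₂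

theorem ker_eq_span (P : Camera) {c : Fin 4 → ℝ} (hc : c ≠ 0) (h : P.mat *ᵥ c = 0) :
    LinearMap.ker P.matC.mulVecLin = Submodule.span ℂ {algebraMap ℝ ℂ ∘ c} := by
  have hc' : (algebraMap ℝ ℂ ∘ c) ≠ 0 := by
    intro h0
    apply hc
    ext i
    simpa using congrFun h0 i
  symm
  apply Submodule.eq_of_le_of_finrank_eq
  · rw [Submodule.span_singleton_le_iff_mem, LinearMap.mem_ker, Matrix.mulVecLin_apply,
      P.matC_mulVec, h]
    ext i
    simp
  · rw [P.finrank_ker, finrank_span_singleton hc']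

theorem center_submodule (P : Camera) :
    P.center.submodule = LinearMap.ker P.matC.mulVecLin := by
  rw [center, Projectivization.submodule_mk'']

theorem center_rep (P : Camera) {c : Fin 4 → ℝ} (hc : c ≠ 0) (h : P.mat *ᵥ c = 0) :
    ∃ a : ℂ, a ≠ 0 ∧ P.center.rep = a • (algebraMap ℝ ℂ ∘ c) := by
  have hmem : P.center.rep ∈ Submodule.span ℂ {algebraMap ℝ ℂ ∘ c} := by
    rw [← P.ker_eq_span hc h, ← P.center_submodule, Projectivization.submodule_eq]
    exact Submodule.mem_span_singleton_self _
  obtain ⟨a, ha⟩ := Submodule.mem_span_singleton.1 hmem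
  refine ⟨a, ?_, ha.symm⟩
  rintro rfl
  exact P.center.rep_nonzero (by rw [← ha, zero_smul])

theorem center_eq (P P' : Camera) {c : Fin 4 → ℝ} (hc : c ≠ 0) (h : P.mat *ᵥ c = 0)
    (h' : P'.mat *ᵥ c = 0) : P.center = P'.center := by
  apply Projectivization.submodule_injective
  rw [center_submodule, center_submodule, P.ker_eq_span hc h, P'.ker_eq_span hc h']

theorem exists_common_kernel (P P' : Camera) (h : P.center = P'.center) :
    ∃ c : Fin 4 → ℝ, c ≠ 0 ∧ P.mat *ᵥ c = 0 ∧ P'.mat *ᵥ c = 0 := by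
  obtain ⟨c, hc, hP⟩ := P.exists_real_kernel
  refine ⟨c, hc, hP, ?_⟩
  have hmem : (algebraMap ℝ ℂ ∘ c) ∈ LinearMap.ker P'.matC.mulVecLin := by
    rw [← P'.center_submodule, ← h, P.center_submodule, P.ker_eq_span hc hP]
    exact Submodule.mem_span_singleton_self _
  rw [LinearMap.mem_ker, Matrix.mulVecLin_apply, P'.matC_mulVec] at hmem
  ext i
  simpa using congrFun hmem i

theorem pairMatrix_mulVec_eq_zero_iff (P P' : Camera) (x y : Fin 3 → ℝ) (z : Fin 6 → ℝ) :
    pairMatrix P P' x y *ᵥ z = 0 ↔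
      P.mat *ᵥ ![z 0, z 1, z 2, z 3] + z 4 • x = 0 ∧
      P'.mat *ᵥ ![z 0, z 1, z 2, z 3] + z 5 • y = 0 := by
  have hz : z = Sum.elim ![z 0, z 1, z 2, z 3] ![z 4, z 5] ∘
      (finSumFinEquiv : Fin 4 ⊕ Fin 2 ≃ Fin 6).symm := by
    rw [Equiv.eq_comp_symm]
    ext i
    rcases i with i | i <;> fin_cases i <;> rfl
  have hx : (Matrix.of fun i => ![x i, 0] : Matrix (Fin 3) (Fin 2) ℝ) *ᵥ ![z 4, z 5] = z 4 • x := by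
    ext i
    simp [Matrix.mulVec, dotProduct, mul_comm]
  have hy : (Matrix.of fun i => ![0, y i] : Matrix (Fin 3) (Fin 2) ℝ) *ᵥ ![z 4, z 5] = z 5 • y := by
    ext i
    simp [Matrix.mulVec, dotProduct, mul_comm]
  have key : pairMatrix P P' x y *ᵥ z =
      Sum.elim (P.mat *ᵥ ![z 0, z 1, z 2, z 3] + z 4 • x)
        (P'.mat *ᵥ ![z 0, z 1, z 2, z 3] + z 5 • y) ∘
      (finSumFinEquiv : Fin 3 ⊕ Fin 3 ≃ Fin 6).symm := by
    conv_lhs => rw [hz]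
    rw [pairMatrix, Matrix.reindex_apply, Matrix.submatrix_mulVec_equiv, Function.comp_assoc]
    simp only [Equiv.symm_symm, Equiv.symm_comp_self, Function.comp_id]
    rw [Matrix.fromBlocks_mulVec]
    simp only [Sum.elim_comp_inl, Sum.elim_comp_inr, hx, hy]
  rw [key]
  constructor
  · intro h
    have h' := (Equiv.comp_symm_eq _ _ _).1 h
    exact ⟨funext fun i => congrFun h' (Sum.inl i), funext fun i => congrFun h' (Sum.inr i)⟩
  · rintro ⟨h, h'⟩
    rw [h, h']
    ext i
    rcases (finSumFinEquiv : Fin 3 ⊕ Fin 3 ≃ Fin 6).symm i with j | j <;> simp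

theorem pairMatrix_left (P P' : Camera) (x y : Fin 3 → ℝ) : pairMatrix P P' x y =
    (pairMatrix P P' 0 y).updateCol 4
      (Sum.elim x 0 ∘ (finSumFinEquiv : Fin 3 ⊕ Fin 3 ≃ Fin 6).symm) := by
  ext i j
  obtain ⟨i, rfl⟩ := (finSumFinEquiv : Fin 3 ⊕ Fin 3 ≃ Fin 6).surjective i
  rcases i with i | i <;> fin_cases i <;> fin_cases j <;> rfl

theorem pairMatrix_right (P P' : Camera) (x y : Fin 3 → ℝ) : pairMatrix P P' x y =
    (pairMatrix P P' x 0).updateCol 5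
      (Sum.elim 0 y ∘ (finSumFinEquiv : Fin 3 ⊕ Fin 3 ≃ Fin 6).symm) := by
  ext i j
  obtain ⟨i, rfl⟩ := (finSumFinEquiv : Fin 3 ⊕ Fin 3 ≃ Fin 6).surjective i
  rcases i with i | i <;> fin_cases i <;> fin_cases j <;> rfl

/-- The bilinear form `(x, y) ↦ det [P x 0; P' 0 y]`. -/
noncomputable def pairForm (P P' : Camera) : (Fin 3 → ℝ) →ₗ[ℝ] (Fin 3 → ℝ) →ₗ[ℝ] ℝ :=
  LinearMap.mk₂ ℝ (fun x y => (pairMatrix P P' x y).det)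
    (fun x x' y => by
      rw [pairMatrix_left P P' (x + x'), pairMatrix_left P P' x, pairMatrix_left P P' x',
        ← Matrix.det_updateCol_add]
      congr 2
      ext i
      rcases h : (finSumFinEquiv : Fin 3 ⊕ Fin 3 ≃ Fin 6).symm i with j | j <;> simp [h])
    (fun c x y => by
      rw [pairMatrix_left P P' (c • x), pairMatrix_left P P' x, smul_eq_mul,
        ← Matrix.det_updateCol_smul]
      congr 2
      ext i
      rcases h : (finSumFinEquiv : Fin 3 ⊕ Fin 3 ≃ Fin 6).symm i with j | j <;> simp [h])
    (fun x y y' => by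
      rw [pairMatrix_right P P' x (y + y'), pairMatrix_right P P' x y, pairMatrix_right P P' x y',
        ← Matrix.det_updateCol_add]
      congr 2
      ext i
      rcases h : (finSumFinEquiv : Fin 3 ⊕ Fin 3 ≃ Fin 6).symm i with j | j <;> simp [h])
    (fun c x y => by
      rw [pairMatrix_right P P' x (c • y), pairMatrix_right P P' x y, smul_eq_mul,
        ← Matrix.det_updateCol_smul]
      congr 2
      ext i
      rcases h : (finSumFinEquiv : Fin 3 ⊕ Fin 3 ≃ Fin 6).symm i with j | j <;> simp [h])

theorem pairForm_eq_of_fundamentalMatrix_eq {P P' Q Q' : Camera} {c : ℝ}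
    (h : Q.fundamentalMatrix Q' = c • P.fundamentalMatrix P') :
    pairForm Q Q' = c • pairForm P P' := by
  apply LinearMap.pi_ext'
  intro a
  ext b
  simpa [fundamentalMatrix, pairForm] using congrFun (congrFun h a) b

theorem pairForm_self (P P' : Camera) (v : Fin 4 → ℝ) :
    pairForm P P' (P.mat *ᵥ v) (P'.mat *ᵥ v) = 0 := by
  rw [pairForm, LinearMap.mk₂_apply]
  rw [← Matrix.exists_mulVec_eq_zero_iff]
  refine ⟨![v 0, v 1, v 2, v 3, -1, -1], fun h => ?_, ?_⟩
  · simpa using congrFun h 4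
  · rw [pairMatrix_mulVec_eq_zero_iff]
    have hv : ![v 0, v 1, v 2, v 3] = v := by
      ext i
      fin_cases i <;> rfl
    simp [hv]

/-- A kernel vector of the 6 × 6 matrix is a space vector with two scalars relating its images to x
and y. Together with `pairForm_self`, this separates fundamental matrices. -/
theorem pairForm_ne_zero {P P' : Camera} {x y : Fin 3 → ℝ}
    (h : ∀ (v : Fin 4 → ℝ) (s t : ℝ), P.mat *ᵥ v = s • x → P'.mat *ᵥ v = t • y →
      v = 0 ∧ s = 0 ∧ t = 0) : pairForm P P' x y ≠ 0 := by
  rw [pairForm, LinearMap.mk₂_apply, Ne, ← Matrix.exists_mulVec_eq_zero_iff]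
  rintro ⟨z, hz, h0⟩
  rw [pairMatrix_mulVec_eq_zero_iff] at h0
  obtain ⟨hv, hs, ht⟩ := h ![z 0, z 1, z 2, z 3] (-z 4) (-z 5)
    (by rw [neg_smul]; exact eq_neg_of_add_eq_zero_left h0.1)
    (by rw [neg_smul]; exact eq_neg_of_add_eq_zero_left h0.2)
  apply hz
  ext i
  fin_cases i
  · exact congrFun hv 0
  · exact congrFun hv 1
  · exact congrFun hv 2
  · exact congrFun hv 3
  · exact neg_eq_zero.1 hs
  · exact neg_eq_zero.1 ht

end Camera

/-- A zero vector, as produced at a camera centre, is a multiple of every image point, so either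
vector may vanish. -/
theorem exists_imagePoint {u w : Fin 3 → ℂ} (h : Parallel u w) :
    ∃ (s : ImagePlane) (c c' : ℂ), u = c • s.rep ∧ w = c' • s.rep := by
  have aux : ∀ u w : Fin 3 → ℂ, Parallel u w → u ≠ 0 →
      ∃ (s : ImagePlane) (c c' : ℂ), u = c • s.rep ∧ w = c' • s.rep := by
    intro u w h hu
    obtain ⟨i, hi⟩ := Function.ne_iff.1 hu
    obtain ⟨a, ha⟩ := Projectivization.exists_smul_eq_mk_rep ℂ u hu
    have hu' : u = (a⁻¹ : ℂˣ) • (Projectivization.mk ℂ u hu).rep := by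
      rw [← ha, inv_smul_smul]
    have hw : w = (w i / u i) • u := by
      ext j
      have := h i j
      simp only [Pi.zero_apply] at hi
      simp only [Pi.smul_apply, smul_eq_mul]
      field_simp
      linear_combination this
    refine ⟨Projectivization.mk ℂ u hu, (a⁻¹ : ℂˣ), (w i / u i) * (a⁻¹ : ℂˣ), hu', ?_⟩
    rw [mul_smul]
    nth_rw 1 [hw]
    congr 1
  by_cases hu : u = 0
  · by_cases hw : w = 0
    · refine ⟨Projectivization.mk ℂ (fun _ => 1) (fun h => one_ne_zero (congrFun h 0)), 0, 0, ?_, ?_⟩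
        <;> simp [hu, hw]
    · obtain ⟨s, c, c', h₁, h₂⟩ := aux w u (fun i j => by linear_combination -h i j) hw
      exact ⟨s, c', c, h₂, h₁⟩
  · exact aux u w h hu


/-! ### Base change to ℂ and factorisation of cameras through the model projections. -/

namespace QuarticCoeff

/-- Base change of the coefficients. -/
def map {k k' : Type*} (φ : k → k') (q : QuarticCoeff k) : QuarticCoeff k' :=
  ⟨φ q.a, φ q.b, φ q.c, φ q.d, φ q.e, φ q.f, φ q.g, φ q.h⟩

variable {k k' : Type*} [Field k] [Field k'] (φ : k →+* k') (q : QuarticCoeff k)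

theorem form₁_map (v : Fin 4 → k) : (q.map φ).form₁ (φ ∘ v) = φ (q.form₁ v) := by
  simp [form₁, map]

theorem form₂_map (v : Fin 4 → k) : (q.map φ).form₂ (φ ∘ v) = φ (q.form₂ v) := by
  simp [form₂, map]

theorem OnCurve.map {q : QuarticCoeff k} {p : Fin 4 → k} (h : q.OnCurve p) :
    (q.map φ).OnCurve (φ ∘ p) :=
  ⟨by simp [h.affine], by rw [form₁_map, h.zero₁, map_zero], by rw [form₂_map, h.zero₂, map_zero]⟩

theorem matrix₁_map : q.matrix₁.map φ = (q.map φ).matrix₁ := by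
  have h2 : φ 2 = 2 := map_ofNat φ 2
  ext i j
  fin_cases i <;> fin_cases j <;> simp [matrix₁, map, h2]

theorem matrix₂_map : q.matrix₂.map φ = (q.map φ).matrix₂ := by
  have h2 : φ 2 = 2 := map_ofNat φ 2
  ext i j
  fin_cases i <;> fin_cases j <;> simp [matrix₂, map, h2]

theorem baseCamera_map : (baseCamera k).map φ = baseCamera k' := by
  ext i j
  fin_cases i <;> fin_cases j <;> simp [baseCamera]

theorem sourceCamera_map (p : Fin 4 → k) :
    (sourceCamera p).map φ = sourceCamera (φ ∘ p) := by
  ext i j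
  fin_cases i <;> fin_cases j <;> simp [sourceCamera]

theorem targetCamera_map (p : Fin 4 → k) :
    (q.targetCamera p).map φ = (q.map φ).targetCamera (φ ∘ p) := by
  ext i j
  fin_cases i <;> fin_cases j <;> simp [targetCamera, sigma, beta, map]

theorem exists_eq_mul_baseCamera (M : Matrix (Fin 3) (Fin 4) k) (h : ∀ i, M i 3 = 0) :
    ∃ T : Matrix (Fin 3) (Fin 3) k, M = T * baseCamera k := by
  refine ⟨Matrix.of fun i => ![M i 0, M i 1, M i 2], ?_⟩
  ext i j
  fin_cases j <;> simp [Matrix.mul_apply, Fin.sum_univ_three, baseCamera, h]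

theorem exists_eq_mul_sourceCamera (M : Matrix (Fin 3) (Fin 4) k) {p : Fin 4 → k}
    (hp : p 0 = 1) (h : M *ᵥ p = 0) : ∃ T : Matrix (Fin 3) (Fin 3) k, M = T * sourceCamera p := by
  refine ⟨Matrix.of fun i => ![-M i 1, -M i 2, M i 3], ?_⟩
  ext i j
  have hi := congrFun h i
  simp only [Matrix.mulVec, dotProduct, Fin.sum_univ_four, hp, Pi.zero_apply, mul_one] at hi
  fin_cases j <;> simp [Matrix.mul_apply, Fin.sum_univ_three, sourceCamera]
  linear_combination hi

theorem baseCamera_vecMul_eq_zero {r : Fin 3 → k} (h : r ᵥ* baseCamera k = 0) : r = 0 := by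
  ext i
  have h₀ := congrFun h 0
  have h₁ := congrFun h 1
  have h₂ := congrFun h 2
  simp [baseCamera, Matrix.vecMul, dotProduct, Fin.sum_univ_three] at h₀ h₁ h₂
  fin_cases i <;> simp [h₀, h₁, h₂]

theorem base_target_common_kernel (q : QuarticCoeff k) {p y : Fin 4 → k}
    (h : baseCamera k *ᵥ y = 0) (h' : q.targetCamera p *ᵥ y = 0) : y = 0 := by
  rw [baseCamera_mulVec] at h
  rw [targetCamera_mulVec] at h'
  have h₀ := congrFun h 0
  have h₁ := congrFun h 1
  have h₂ := congrFun h 2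
  have h₃ := congrFun h' 1
  simp at h₀ h₁ h₂ h₃
  rw [h₀, h₁, h₂] at h₃
  ext i
  fin_cases i
  · exact h₀
  · exact h₁
  · exact h₂
  · simpa using h₃

end QuarticCoeff


/-! ### Assembling the conjugate configuration. -/

open QuarticCoeff

theorem quad_smul {k : Type*} [Field k] (M : Matrix (Fin 4) (Fin 4) k) (a : k) (v : Fin 4 → k) :
    quad M (a • v) = a ^ 2 * quad M v := by
  simp only [quad, Matrix.mulVec_smul, smul_dotProduct, dotProduct_smul, smul_eq_mul]
  ring

theorem map_mulVec_comp {k k' : Type*} [Field k] [Field k'] (φ : k →+* k') {m n : ℕ}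
    (M : Matrix (Fin m) (Fin n) k) (v : Fin n → k) : M.map φ *ᵥ (φ ∘ v) = φ ∘ (M *ᵥ v) := by
  ext i
  exact (RingHom.map_mulVec φ M v i).symm

theorem quad_map {k k' : Type*} [Field k] [Field k'] (φ : k →+* k')
    (M : Matrix (Fin 4) (Fin 4) k) (v : Fin 4 → k) : quad (M.map φ) (φ ∘ v) = φ (quad M v) := by
  rw [quad, map_mulVec_comp, quad, RingHom.map_dotProduct]

theorem parallel_mulVec {k : Type*} [Field k] {u w : Fin 3 → k} (h : Parallel u w)
    (T : Matrix (Fin 3) (Fin 3) k) : Parallel (T *ᵥ u) (T *ᵥ w) := by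
  intro i j
  simp only [Matrix.mulVec, dotProduct, Finset.sum_mul_sum]
  rw [Finset.sum_comm]
  exact Finset.sum_congr rfl fun a _ => Finset.sum_congr rfl fun b _ => by
    linear_combination T i b * T j a * h b a

/-- Independence of the gradients at a real point that is not singular. -/
theorem gradients_independent {M₁ M₂ : Matrix (Fin 4) (Fin 4) ℝ}
    (hd₁ : ∀ i, MvPolynomial.pderiv i (quadPoly M₁) = linearPoly (2 • M₁ i))
    (hd₂ : ∀ i, MvPolynomial.pderiv i (quadPoly M₂) = linearPoly (2 • M₂ i))
    {x : Space} (hx : x ∈ quarticCurve (quadPoly M₁) (quadPoly M₂))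
    (hs : ¬ IsSingularPoint (quadPoly M₁) (quadPoly M₂) x) {a : ℂ} {c : Fin 4 → ℝ}
    (hrep : x.rep = a • (algebraMap ℝ ℂ ∘ c)) (α β : ℝ)
    (h : α • M₁ *ᵥ c + β • M₂ *ᵥ c = 0) : α = 0 ∧ β = 0 := by
  have hlin : LinearIndependent ℂ ![gradient (quadPoly M₁) x, gradient (quadPoly M₂) x] := by
    by_contra hcon
    exact hs ⟨hx, hcon⟩
  have hgrad : ∀ M : Matrix (Fin 4) (Fin 4) ℝ,
      (∀ i, MvPolynomial.pderiv i (quadPoly M) = linearPoly (2 • M i)) →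
      ∀ i, gradient (quadPoly M) x i = 2 * a * ((M *ᵥ c) i : ℝ) := by
    intro M hM i
    rw [gradient, hM, aeval_linearPoly, hrep]
    simp [dotProduct, Matrix.mulVec, Finset.mul_sum]
    exact Finset.sum_congr rfl fun j _ => by ring
  have h0 : (α : ℂ) • gradient (quadPoly M₁) x + (β : ℂ) • gradient (quadPoly M₂) x = 0 := by
    ext i
    have hi := congrArg (Complex.ofReal) (congrFun h i)
    simp only [Pi.add_apply, Pi.smul_apply, smul_eq_mul, Complex.ofReal_add, Complex.ofReal_mul,
      Pi.zero_apply, Complex.ofReal_zero] at hi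
    simp only [Pi.add_apply, Pi.smul_apply, smul_eq_mul, hgrad M₁ hd₁, hgrad M₂ hd₂,
      Pi.zero_apply]
    linear_combination 2 * a * hi
  have := LinearIndependent.pair_iff.1 hlin _ _ h0
  exact ⟨by exact_mod_cast this.1, by exact_mod_cast this.2⟩

/-- Conjugate cameras for cameras whose centres are smooth points of an irreducible quartic. -/
theorem exists_conjugate_cameras {q₁ q₂ : MvPolynomial (Fin 4) ℝ} (hC : IsIrreducibleQuartic q₁ q₂)
    {n : ℕ} (hn : 2 ≤ n) (K : Configuration n)
    (hcenter : ∀ i, (K.camera i).center ∈ quarticCurve q₁ q₂)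
    (hsmooth : ∀ i, ¬ IsSingularPoint q₁ q₂ (K.camera i).center) :
    ∃ Q : Fin n → Camera,
      (∀ i j, i ≠ j → ∀ y, (Q i).mat *ᵥ y = 0 → (Q j).mat *ᵥ y = 0 → y = 0) ∧
      (∀ i j, i ≠ j → ∃ v : Fin 4 → ℝ, ∀ (y : Fin 4 → ℝ) (s t : ℝ),
        (Q i).mat *ᵥ y = s • (K.camera i).mat *ᵥ v →
        (Q j).mat *ᵥ y = t • (K.camera j).mat *ᵥ v → y = 0 ∧ s = 0 ∧ t = 0) ∧
      ∀ x ∈ quarticCurve q₁ q₂, ∃ y : Fin 4 → ℂ, y ≠ 0 ∧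
        ∀ i, Parallel ((K.camera i).matC *ᵥ x.rep) ((Q i).matC *ᵥ y) := by
  classical
  obtain ⟨M₁, hM₁, rfl, hd₁⟩ := exists_eq_quadPoly hC.homogeneous_left
  obtain ⟨M₂, hM₂, rfl, hd₂⟩ := exists_eq_quadPoly hC.homogeneous_right
  have hq := primePencil_of_isIrreducibleQuartic hC
  choose c hc0 hc using fun i => (K.camera i).exists_real_kernel
  choose a ha0 ha using fun i => (K.camera i).center_rep (hc0 i) (hc i)
  have hon : ∀ M : Matrix (Fin 4) (Fin 4) ℝ, ∀ i,
      MvPolynomial.aeval (K.camera i).center.rep (quadPoly M) = 0 → quad M (c i) = 0 := by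
    intro M i h
    rw [aeval_quadPoly, ha, quad_smul, quad_map] at h
    have := (mul_eq_zero.1 h).resolve_left (pow_ne_zero 2 (ha0 i))
    simpa using this
  have hne : ∀ i j, i ≠ j → ∀ t : ℝ, c i ≠ t • c j := by
    intro i j hij t h
    refine hij (K.center_injective ((K.camera i).center_eq _ (hc0 i) (hc i) ?_))
    rw [h, Matrix.mulVec_smul, hc, smul_zero]
  let i₀ : Fin n := ⟨0, by omega⟩
  obtain ⟨U, q, s, t, ξ, r, hU, hpencil, hm₁, hm₂, hU₃, hξ, hξ1⟩ :=
    exists_adapted_coordinates hM₁ hM₂ hq c i₀ (fun i => hon M₁ i (hcenter i).1)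
      (fun i => hon M₂ i (hcenter i).2) hne
      (gradients_independent hd₁ hd₂ (hcenter i₀) (hsmooth i₀) (ha i₀))
  obtain ⟨V, hUV, hVU⟩ : ∃ V : Matrix (Fin 4) (Fin 4) ℝ, U * V = 1 ∧ V * U = 1 :=
    ⟨U⁻¹, Matrix.mul_nonsing_inv _ ((Matrix.isUnit_iff_isUnit_det _).1 hU),
      Matrix.nonsing_inv_mul _ ((Matrix.isUnit_iff_isUnit_det _).1 hU)⟩
  let src : Fin n → Matrix (Fin 3) (Fin 4) ℝ := fun i =>
    if i = i₀ then baseCamera ℝ else sourceCamera (ξ i)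
  let tgt : Fin n → Matrix (Fin 3) (Fin 4) ℝ := fun i =>
    if i = i₀ then baseCamera ℝ else q.targetCamera (ξ i)
  -- Each camera factors through the model projection with its kernel. The same `T i` is later
  -- applied to the conjugate camera, so both images undergo one change of coordinates.
  have hT : ∀ i, ∃ T : Matrix (Fin 3) (Fin 3) ℝ, (K.camera i).mat * U = T * src i := by
    intro i
    by_cases hi : i = i₀
    · simp only [src, hi, if_true]
      refine exists_eq_mul_baseCamera _ fun j => ?_
      have : (K.camera i₀).mat *ᵥ U.col 3 = 0 := by rw [hU₃, hc]
      exact congrFun this j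
    · simp only [src, hi, if_false]
      obtain ⟨h₁, h₂, h₃⟩ := hξ i hi
      refine exists_eq_mul_sourceCamera _ h₁.affine ?_
      have := hc i
      rw [h₃, Matrix.mulVec_smul, Matrix.mulVec_mulVec] at this
      exact (smul_eq_zero.1 this).resolve_left h₂
  choose T hT using hT
  have hTinj : ∀ i (x : Fin 3 → ℝ), x ᵥ* T i = 0 → x = 0 := by
    intro i x hx
    apply (K.camera i).vecMul_eq_zero
    have h : x ᵥ* ((K.camera i).mat * U) = 0 := by
      rw [hT, ← Matrix.vecMul_vecMul, hx, Matrix.zero_vecMul]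
    have h' := congrArg (· ᵥ* V) h
    simpa [Matrix.vecMul_vecMul, Matrix.mul_assoc, hUV] using h'
  have hTdet : ∀ i, (T i).det ≠ 0 := by
    intro i h
    obtain ⟨x, hx, hx0⟩ := Matrix.exists_vecMul_eq_zero_iff.2 h
    exact hx (hTinj i x hx0)
  have hTker : ∀ i (x : Fin 3 → ℝ), T i *ᵥ x = 0 → x = 0 := fun i x hx =>
    Matrix.eq_zero_of_mulVec_eq_zero (hTdet i) hx
  have htgt : ∀ i (x : Fin 3 → ℝ), x ᵥ* tgt i = 0 → x = 0 := by
    intro i x hx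
    by_cases hi : i = i₀
    · simp only [tgt, hi, if_true] at hx
      exact baseCamera_vecMul_eq_zero hx
    · simp only [tgt, hi, if_false] at hx
      exact targetCamera_vecMul_eq_zero hpencil (hξ i hi).1 hx
  have hcommon : ∀ i j, i ≠ j → ∀ y, tgt i *ᵥ y = 0 → tgt j *ᵥ y = 0 → y = 0 := by
    intro i j hij y h h'
    by_cases hi : i = i₀
    · have hj : j ≠ i₀ := fun hj => hij (hi.trans hj.symm)
      simp only [tgt, hi, hj, if_true, if_false] at h h'
      exact q.base_target_common_kernel h h'
    · by_cases hj : j = i₀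
      · simp only [tgt, hi, hj, if_true, if_false] at h h'
        exact q.base_target_common_kernel h' h
      · simp only [tgt, hi, hj, if_false] at h h'
        exact targetCamera_common_kernel hpencil (hξ i hi).1 (hξ j hj).1 (hξ1 i j hi hj hij) h h'
  have hpair : ∀ i j, i ≠ j → ∃ v : Fin 4 → ℝ, ∀ (y : Fin 4 → ℝ) (s t : ℝ),
      tgt i *ᵥ y = s • src i *ᵥ v → tgt j *ᵥ y = t • src j *ᵥ v → y = 0 ∧ s = 0 ∧ t = 0 := by
    intro i j hij
    by_cases hi : i = i₀
    · have hj : j ≠ i₀ := fun hj => hij (hi.trans hj.symm)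
      simp only [src, tgt, hi, hj, if_true, if_false]
      exact base_pair_nondegenerate hpencil (hξ j hj).1
    · by_cases hj : j = i₀
      · simp only [src, tgt, hi, hj, if_true, if_false]
        obtain ⟨v, hv⟩ := base_pair_nondegenerate hpencil (hξ i hi).1
        refine ⟨v, fun y s t h h' => ?_⟩
        obtain ⟨h₁, h₂, h₃⟩ := hv y t s h' h
        exact ⟨h₁, h₃, h₂⟩
      · simp only [src, tgt, hi, hj, if_false]
        exact pair_nondegenerate hpencil (hξ i hi).1 (hξ j hj).1 (hξ1 i j hi hj hij)
  refine ⟨fun i => Camera.ofVecMul (T i * tgt i) fun x hx => ?_, fun i j hij y h h' => ?_,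
    fun i j hij => ?_, fun x hx => ?_⟩
  · rw [← Matrix.vecMul_vecMul] at hx
    exact hTinj i x (htgt i _ hx)
  · simp only [Camera.ofVecMul, ← Matrix.mulVec_mulVec] at h h'
    exact hcommon i j hij y (hTker i _ h) (hTker j _ h')
  · obtain ⟨v, hv⟩ := hpair i j hij
    have hcancel : ∀ i (y : Fin 4 → ℝ) (s : ℝ),
        (T i * tgt i) *ᵥ y = s • (K.camera i).mat *ᵥ (U *ᵥ v) → tgt i *ᵥ y = s • src i *ᵥ v := by
      intro i y s h
      rw [Matrix.mulVec_mulVec, hT, ← Matrix.mulVec_mulVec, ← Matrix.mulVec_mulVec,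
        ← Matrix.mulVec_smul] at h
      rw [← sub_eq_zero]
      apply hTker i
      rw [Matrix.mulVec_sub, h, sub_self]
    exact ⟨U *ᵥ v, fun y s t h h' => hv y s t (hcancel i y s h) (hcancel j y t h')⟩
  · obtain ⟨ζ, hζ⟩ : ∃ ζ, U.map (algebraMap ℝ ℂ) *ᵥ ζ = x.rep := by
      refine ⟨V.map (algebraMap ℝ ℂ) *ᵥ x.rep, ?_⟩
      rw [Matrix.mulVec_mulVec, ← Matrix.map_mul, hUV, Matrix.map_one _ (map_zero _) (map_one _),
        Matrix.one_mulVec]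
    have hx₁ := hx.1
    have hx₂ := hx.2
    rw [aeval_quadPoly, ← hζ] at hx₁ hx₂
    have hzero : ∀ A B : Matrix (Fin 4) (Fin 4) ℝ, Uᵀ * A * U = B →
        quad (B.map (algebraMap ℝ ℂ)) ζ =
          quad (A.map (algebraMap ℝ ℂ)) (U.map (algebraMap ℝ ℂ) *ᵥ ζ) := by
      rintro A B rfl
      rw [quad_mulVec, Matrix.map_mul, Matrix.map_mul, Matrix.transpose_map]
    have hf₁ : (q.map (algebraMap ℝ ℂ)).form₁ ζ = 0 := by
      rw [← quad_matrix₁, ← matrix₁_map, hzero _ _ hm₁]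
      have : (s • M₁ + t • M₂).map (algebraMap ℝ ℂ) =
          (s : ℂ) • M₁.map (algebraMap ℝ ℂ) + (t : ℂ) • M₂.map (algebraMap ℝ ℂ) := by
        ext i j
        simp
      rw [this]
      simp only [quad] at hx₁ hx₂ ⊢
      rw [Matrix.add_mulVec, Matrix.smul_mulVec, Matrix.smul_mulVec, dotProduct_add,
        dotProduct_smul, dotProduct_smul, hx₁, hx₂]
      simp
    have hf₂ : (q.map (algebraMap ℝ ℂ)).form₂ ζ = 0 := by
      rw [← quad_matrix₂, ← matrix₂_map, hzero _ _ hm₂]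
      have : (s⁻¹ • M₂).map (algebraMap ℝ ℂ) = (s⁻¹ : ℂ) • M₂.map (algebraMap ℝ ℂ) := by
        ext i j
        simp
      rw [this]
      simp only [quad] at hx₂ ⊢
      rw [Matrix.smul_mulVec, dotProduct_smul, hx₂, smul_zero]
    obtain ⟨y, hy, hbase, htarget⟩ := (q.map (algebraMap ℝ ℂ)).exists_conjugate_point hf₁ hf₂
    refine ⟨y, hy, fun i => ?_⟩
    have hP : (K.camera i).matC *ᵥ x.rep =
        (T i).map (algebraMap ℝ ℂ) *ᵥ ((src i).map (algebraMap ℝ ℂ) *ᵥ ζ) := by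
      rw [← hζ, Camera.matC, Matrix.mulVec_mulVec, Matrix.mulVec_mulVec, ← Matrix.map_mul,
        ← Matrix.map_mul, hT]
    have hQ : (Camera.ofVecMul (T i * tgt i) (fun x hx => hTinj i x (htgt i _ (by
        rwa [← Matrix.vecMul_vecMul] at hx)))).matC *ᵥ y =
        (T i).map (algebraMap ℝ ℂ) *ᵥ ((tgt i).map (algebraMap ℝ ℂ) *ᵥ y) := by
      rw [Camera.matC, Camera.ofVecMul, Matrix.mulVec_mulVec, ← Matrix.map_mul]
    rw [hP, hQ]
    apply parallel_mulVec
    by_cases hi : i = i₀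
    · simp only [src, tgt, hi, if_true, baseCamera_map]
      exact hbase
    · simp only [src, tgt, hi, if_false, sourceCamera_map, targetCamera_map]
      exact htarget _ ((hξ i hi).1.map _)

/-- An equivalence would send v to a vector whose images under L are nonzero multiples of those of v
under K. As H may be complex and the hypothesis is real, it is applied to the real and imaginary
parts. -/
theorem not_equivalent {n : ℕ} {K L : Configuration n} {i j : Fin n} {v : Fin 4 → ℝ}
    (h : ∀ (y : Fin 4 → ℝ) (s t : ℝ), (L.camera i).mat *ᵥ y = s • (K.camera i).mat *ᵥ v →
      (L.camera j).mat *ᵥ y = t • (K.camera j).mat *ᵥ v → y = 0 ∧ s = 0 ∧ t = 0) :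
    ¬ K.Equivalent L := by
  rintro ⟨H, -, hH⟩
  set w : Fin 4 → ℂ := H.val *ᵥ (algebraMap ℝ ℂ ∘ v) with hw
  have key : ∀ l, ∃ b : ℂ, b ≠ 0 ∧ ∀ m,
      ((L.camera l).matC *ᵥ w) m = b * (((K.camera l).mat *ᵥ v) m : ℝ) := by
    intro l
    obtain ⟨c, hc, h⟩ := hH l
    refine ⟨c⁻¹, inv_ne_zero hc, fun m => ?_⟩
    have h1 : c • ((L.camera l).matC *ᵥ w) = (K.camera l).matC *ᵥ (algebraMap ℝ ℂ ∘ v) := by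
      rw [← Matrix.smul_mulVec, ← h, hw, Matrix.mulVec_mulVec, Matrix.mul_assoc]
      have : (H⁻¹).val * H.val = 1 := by rw [← Units.val_mul, inv_mul_cancel, Units.val_one]
      rw [this, Matrix.mul_one]
    rw [Camera.matC_mulVec] at h1
    have := congrFun h1 m
    simp only [Pi.smul_apply, smul_eq_mul, Function.comp_apply, Complex.coe_algebraMap] at this
    rw [← this]
    field_simp
  obtain ⟨b, hb, hbi⟩ := key i
  obtain ⟨b', -, hbj⟩ := key j
  have hre : ∀ (P : Camera) (m : Fin 3), (P.mat *ᵥ fun l => (w l).re) m = ((P.matC *ᵥ w) m).re := by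
    intro P m
    simp [Camera.matC, Matrix.mulVec, dotProduct]
  have him : ∀ (P : Camera) (m : Fin 3), (P.mat *ᵥ fun l => (w l).im) m = ((P.matC *ᵥ w) m).im := by
    intro P m
    simp [Camera.matC, Matrix.mulVec, dotProduct]
  have h₁ := (h (fun l => (w l).re) b.re b'.re
    (by ext m; rw [hre, hbi]; simp) (by ext m; rw [hre, hbj]; simp)).2.1
  have h₂ := (h (fun l => (w l).im) b.im b'.im
    (by ext m; rw [him, hbi]; simp) (by ext m; rw [him, hbj]; simp)).2.1
  exact hb (Complex.ext h₁ h₂)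

end Vision

theorem mainTheorem4 (q₁ q₂ : MvPolynomial (Fin 4) ℝ) (hC : Vision.IsIrreducibleQuartic q₁ q₂)
    (n : ℕ) (hn : 2 ≤ n) (K : Vision.Configuration n)
    (hcenter : ∀ i, (K.camera i).center ∈ Vision.quarticCurve q₁ q₂)
    (hsmooth : ∀ i, ¬ Vision.IsSingularPoint q₁ q₂ (K.camera i).center)
    (hpoints : K.points ⊆ Vision.quarticCurve q₁ q₂) :
    K.IsNontrivialCritical := by
  obtain ⟨Q, hcommon, hpair, himage⟩ := Vision.exists_conjugate_cameras hC hn K hcenter hsmooth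
  have hinj : Function.Injective fun i => (Q i).center := by
    intro i j hij
    by_contra hne
    obtain ⟨c, hc, h, h'⟩ := (Q i).exists_common_kernel (Q j) hij
    exact hc (hcommon i j hne c h h')
  let R : Vision.Space → (Fin n → Vision.ImagePlane) → Prop := fun y s =>
    ∀ i, (Q i).IsImage y (s i)
  -- All points sharing an image tuple with a point of K are taken, and S below is the set of all
  -- shared tuples; thus no choice is needed at camera centres, whose images are not unique.
  let L : Vision.Configuration n := ⟨Q, hinj, {y | ∃ x ∈ K.points, ∃ s, K.IsImage x s ∧ R y s}⟩
  have hex : ∀ x ∈ K.points, ∃ y s, K.IsImage x s ∧ R y s := by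
    intro x hx
    obtain ⟨y, hy, hpar⟩ := himage x (hpoints hx)
    choose s c c' hc hc' using fun i => Vision.exists_imagePoint (hpar i)
    refine ⟨Projectivization.mk ℂ y hy, s, fun i => ⟨c i, hc i⟩, fun i => ?_⟩
    obtain ⟨a, ha⟩ := Projectivization.exists_smul_eq_mk_rep ℂ y hy
    refine ⟨a * c' i, ?_⟩
    rw [← ha, mul_smul, ← hc' i, Units.smul_def, Matrix.mulVec_smul]
  refine ⟨L, ⟨⟨{s | ∃ x ∈ K.points, ∃ y, K.IsImage x s ∧ R y s}, ⟨?_, ?_⟩, ⟨?_, ?_⟩⟩, ?_⟩, ?_⟩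
  · rintro s ⟨x, hx, y, h, -⟩
    exact ⟨x, hx, h⟩
  · intro x hx
    obtain ⟨y, s, h, h'⟩ := hex x hx
    exact ⟨s, ⟨x, hx, y, h, h'⟩, h⟩
  · rintro s ⟨x, hx, y, h, h'⟩
    exact ⟨y, ⟨x, hx, s, h, h'⟩, h'⟩
  · rintro y ⟨x, hx, s, h, h'⟩
    exact ⟨s, ⟨x, hx, y, h, h'⟩, h'⟩
  · obtain ⟨v, hv⟩ := hpair ⟨0, by omega⟩ ⟨1, by omega⟩ (by simp [Fin.ext_iff])
    exact Vision.not_equivalent hv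
  -- On the two images of v under K the bilinear form of K vanishes, while that of L does not.
  · rintro i j hij ⟨c, -, hF⟩
    obtain ⟨v, hv⟩ := hpair i j hij
    apply Vision.Camera.pairForm_ne_zero hv
    rw [Vision.Camera.pairForm_eq_of_fundamentalMatrix_eq hF]
    simp [Vision.Camera.pairForm_self]
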